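/- Write $[A]^2=\{(x,y)\in A^2 : x<y\}$ for $A\subseteq\mathbb N$. A coloring $f:[\mathbb N]^2\to\mathbb N$ is \emph{2-bounded} if $|f^{-1}(c)|\le 2$ for every $c\in\mathbb N$, and \emph{weakly rainbow-stable} if for all $x,y\in\mathbb N$ either $f(x,s)=f(y,s)$ for all but finitely many $s$, or $f(x,s)\neq f(y,s)$ for all but finitely many $s$. A set $R\subseteq\mathbb N$ is an \emph{$f$-rainbow} if $f$ is injective on $[R]^2$. A set $Y$ is \emph{low over} $X$ if $(Y\oplus X)'\le_T X'$, and \emph{low} if $Y'\le_T\emptyset'$, where $'$ is the Turing jump. $\mathsf{RRT}^2_2$ is the statement of second order arithmetic ``every 2-bounded coloring $f:[\mathbb N]^2\to\mathbb N$ has an infinite $f$-rainbow'', and $\mathsf{WSRRT}^2_2$ is its restriction to weakly rainbow-stable colorings. \textbf{Theorem.} (1) For every set $X\subseteq\mathbb N$ and every weakly rainbow-stable $X$-computable 2-bounded coloring $f:[\mathbb N]^2\to\mathbb N$, there is an infinite $f$-rainbow that is low over $X$. (2) There is an $\omega$-model of $\mathsf{RCA}_0+\mathsf{WSRRT}^2_2$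 all of whose sets are low. (3) $\mathsf{WSRRT}^2_2$ does not imply $\mathsf{RRT}^2_2$ over $\mathsf{RCA}_0$: some model of $\mathsf{RCA}_0+\mathsf{WSRRT}^2_2$ is not a model of $\mathsf{RRT}^2_2$. -/

import Mathlib

namespace RainbowRamsey

/-! ### Oracle computability, Turing jump, lowness -/

/-- The characteristic function of a set of natural numbers, as an oracle. -/
noncomputable def oracle (A : Set ℕ) : ℕ →. ℕ :=
  open Classical in fun n => Part.some (if n ∈ A then 1 else 0)

/-- Turing reducibility between sets of natural numbers. -/
def TuringLE (A B : Set ℕ) : Prop := TuringReducible (oracle A) (oracle B)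

/-- The join `A ⊕ B`: even numbers code `A`, odd numbers code `B`. -/
def join (A B : Set ℕ) : Set ℕ := {n | (∃ a ∈ A, n = 2 * a) ∨ (∃ b ∈ B, n = 2 * b + 1)}

/-- The initial segment of (the characteristic sequence of) `A` of length `k`. -/
noncomputable def initSeg (A : Set ℕ) (k : ℕ) : List Bool :=
  open Classical in (List.range k).map fun i => decide (i ∈ A)

/-- The `e`-th set computably enumerable in `A`:
`W_e^A = {n | there is an initial segment σ of A with (σ, n) ∈ W_e}`, where `W_e` is the domain of
the `e`-th partial computable function. -/
noncomputable def ceSet (A : Set ℕ) (e : ℕ) : Set ℕ :=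
  {n | ∃ k, ((Denumerable.ofNat Nat.Partrec.Code e).eval (Encodable.encode (initSeg A k, n))).Dom}

/-- The Turing jump `A' = {e | e ∈ W_e^A}`. -/
noncomputable def jump (A : Set ℕ) : Set ℕ := {e | e ∈ ceSet A e}

/-- `Y` is low over `X`: `(Y ⊕ X)' ≤_T X'`. -/
def LowOver (Y X : Set ℕ) : Prop := TuringLE (jump (join Y X)) (jump X)

/-- `Y` is low: `Y' ≤_T ∅'`. -/
def Low (Y : Set ℕ) : Prop := TuringLE (jump Y) (jump ∅)

/-! ### Colorings of pairs

A coloring `[ℕ]² → ℕ` is given by `f : ℕ → ℕ → ℕ`, of which only the values `f x y` with `x < y`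
are ever considered. -/

/-- `f` is 2-bounded: each color is used by at most two pairs. -/
def TwoBounded (f : ℕ → ℕ → ℕ) : Prop :=
  ∀ c, {p : ℕ × ℕ | p.1 < p.2 ∧ f p.1 p.2 = c}.encard ≤ 2

/-- `f` is weakly rainbow-stable. -/
def WeaklyRainbowStable (f : ℕ → ℕ → ℕ) : Prop :=
  ∀ x y, (∀ᶠ s in Filter.atTop, f x s = f y s) ∨ (∀ᶠ s in Filter.atTop, f x s ≠ f y s)

/-- `R` is an `f`-rainbow: `f` is injective on the pairs of elements of `R`. -/
def IsRainbow (f : ℕ → ℕ → ℕ) (R : Set ℕ) : Prop :=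
  Set.InjOn (fun p : ℕ × ℕ => f p.1 p.2) {p | p.1 ∈ R ∧ p.2 ∈ R ∧ p.1 < p.2}

/-- The coloring `f : [ℕ]² → ℕ` is `X`-computable. -/
def ColoringComputableIn (X : Set ℕ) (f : ℕ → ℕ → ℕ) : Prop :=
  ∃ F : ℕ × ℕ → ℕ, ComputableIn {oracle X} F ∧ ∀ x y, x < y → F (x, y) = f x y

/-! ### Second order arithmetic -/

/-- Structures for the language of second order arithmetic: a first-order part `M` interpreting
`0, 1, +, ·, <`, and a collection `S` of subsets of `M` over which the set variables range. -/
structure L2Structure where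
  M : Type
  zero : M
  one : M
  add : M → M → M
  mul : M → M → M
  lt : M → M → Prop
  S : Set (Set M)

/-- The ω-structure with second-order part `S`. -/
def omegaStructure (S : Set (Set ℕ)) : L2Structure where
  M := ℕ
  zero := 0
  one := 1
  add := (· + ·)
  mul := (· * ·)
  lt := (· < ·)
  S := S

/-- Number terms in `k` free number variables. -/
inductive NumTerm (k : ℕ) : Type
  | var (i : Fin k) : NumTerm k
  | zero : NumTerm k
  | one : NumTerm k
  | add (s t : NumTerm k) : NumTerm k
  | mul (s t : NumTerm k) : NumTerm k

/-- Bounded quantifier (`Σ⁰₀`) formulas with `m` free set variables and `k` free number variables.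
In `ball t φ`, which is `∀ x < t, φ`, the bound variable is variable `0` of `φ`. -/
inductive BddFormula (m : ℕ) : ℕ → Type
  | eq {k : ℕ} (s t : NumTerm k) : BddFormula m k
  | lt {k : ℕ} (s t : NumTerm k) : BddFormula m k
  | mem {k : ℕ} (t : NumTerm k) (X : Fin m) : BddFormula m k
  | neg {k : ℕ} (φ : BddFormula m k) : BddFormula m k
  | and {k : ℕ} (φ ψ : BddFormula m k) : BddFormula m k
  | ball {k : ℕ} (t : NumTerm k) (φ : BddFormula m (k + 1)) : BddFormula m k

namespace L2Structure

variable (N : L2Structure)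

/-- The value of a term. -/
def val {k : ℕ} (v : Fin k → N.M) : NumTerm k → N.M
  | .var i => v i
  | .zero => N.zero
  | .one => N.one
  | .add s t => N.add (val v s) (val v t)
  | .mul s t => N.mul (val v s) (val v t)

/-- Truth of a bounded quantifier formula, with set parameters `A` and number parameters `v`. -/
def Holds {m : ℕ} (A : Fin m → Set N.M) : {k : ℕ} → (Fin k → N.M) → BddFormula m k → Prop
  | _, v, .eq s t => N.val v s = N.val v t
  | _, v, .lt s t => N.lt (N.val v s) (N.val v t)
  | _, v, .mem t X => N.val v t ∈ A X
  | _, v, .neg φ => ¬ Holds A v φ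
  | _, v, .and φ ψ => Holds A v φ ∧ Holds A v ψ
  | _, v, .ball t φ => ∀ x, N.lt x (N.val v t) → Holds A (Fin.cons x v) φ

/-- `P` is defined in `N` by a `Σ⁰₁` formula `∃ y, θ(y, x, v, A)` with `θ` a bounded quantifier
formula, number parameters `v` from `N.M` and set parameters `A` from `N.S`. -/
def IsSigma01 (P : N.M → Prop) : Prop :=
  ∃ (m k : ℕ) (θ : BddFormula m (k + 2)) (A : Fin m → Set N.M) (v : Fin k → N.M),
    (∀ i, A i ∈ N.S) ∧
    ∀ x, P x ↔ ∃ y, N.Holds A (Fin.cons y (Fin.cons x v : Fin (k + 1) → N.M)) θ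

/-- `P` is defined in `N` by a `Π⁰₁` formula `∀ y, θ(y, x, v, A)` with parameters from `N`. -/
def IsPi01 (P : N.M → Prop) : Prop :=
  ∃ (m k : ℕ) (θ : BddFormula m (k + 2)) (A : Fin m → Set N.M) (v : Fin k → N.M),
    (∀ i, A i ∈ N.S) ∧
    ∀ x, P x ↔ ∀ y, N.Holds A (Fin.cons y (Fin.cons x v : Fin (k + 1) → N.M)) θ

/-- `N` is a model of `RCA₀`: the basic axioms, `Σ⁰₁` induction and `Δ⁰₁` comprehension. -/
structure ModelsRCA₀ : Prop where
  succ_ne_zero : ∀ n, N.add n N.one ≠ N.zero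
  succ_inj : ∀ m n, N.add m N.one = N.add n N.one → m = n
  add_zero : ∀ m, N.add m N.zero = m
  add_succ : ∀ m n, N.add m (N.add n N.one) = N.add (N.add m n) N.one
  mul_zero : ∀ m, N.mul m N.zero = N.zero
  mul_succ : ∀ m n, N.mul m (N.add n N.one) = N.add (N.mul m n) m
  not_lt_zero : ∀ m, ¬ N.lt m N.zero
  lt_succ : ∀ m n, N.lt m (N.add n N.one) ↔ N.lt m n ∨ m = n
  sigma01_induction : ∀ P : N.M → Prop, N.IsSigma01 P →
    P N.zero → (∀ n, P n → P (N.add n N.one)) → ∀ n, P n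
  delta01_comprehension : ∀ P : N.M → Prop, N.IsSigma01 P → N.IsPi01 P → {n | P n} ∈ N.S

/-- The usual pairing code `(i + j)² + i` of second order arithmetic. -/
def pair (i j : N.M) : N.M := N.add (N.mul (N.add i j) (N.add i j)) i

/-- In `N`, the set `F` contains the triple coding that the pair `x, y` has color `c`. -/
def HasColor (F : Set N.M) (x y c : N.M) : Prop := N.pair (N.pair x y) c ∈ F

/-- In `N`, the set `F` codes (the graph of) a coloring `[ℕ]² → ℕ`. -/
def IsColoring (F : Set N.M) : Prop := ∀ x y, N.lt x y → ∃! c, N.HasColor F x y c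

/-- In `N`, the coloring coded by `F` is 2-bounded: no color is used by three distinct pairs. -/
def TwoBounded (F : Set N.M) : Prop :=
  ∀ c x₁ y₁ x₂ y₂ x₃ y₃, N.lt x₁ y₁ → N.lt x₂ y₂ → N.lt x₃ y₃ →
    N.HasColor F x₁ y₁ c → N.HasColor F x₂ y₂ c → N.HasColor F x₃ y₃ c →
    (x₁ = x₂ ∧ y₁ = y₂) ∨ (x₁ = x₃ ∧ y₁ = y₃) ∨ (x₂ = x₃ ∧ y₂ = y₃)

/-- In `N`, the coloring coded by `F` is weakly rainbow-stable. -/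
def WeaklyRainbowStable (F : Set N.M) : Prop :=
  ∀ x y,
    (∃ t, ∀ s, N.lt t s → N.lt x s → N.lt y s → ∃ c, N.HasColor F x s c ∧ N.HasColor F y s c) ∨
    (∃ t, ∀ s, N.lt t s → N.lt x s → N.lt y s → ¬ ∃ c, N.HasColor F x s c ∧ N.HasColor F y s c)

/-- In `N`, the set `R` is unbounded, that is, infinite. -/
def IsInfinite (R : Set N.M) : Prop := ∀ t, ∃ x ∈ R, N.lt t x

/-- In `N`, the set `R` is a rainbow for the coloring coded by `F`. -/
def IsRainbow (F R : Set N.M) : Prop :=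
  ∀ x₁ ∈ R, ∀ y₁ ∈ R, ∀ x₂ ∈ R, ∀ y₂ ∈ R, N.lt x₁ y₁ → N.lt x₂ y₂ →
    ∀ c, N.HasColor F x₁ y₁ c → N.HasColor F x₂ y₂ c → x₁ = x₂ ∧ y₁ = y₂

/-- The sentence `RRT²₂`, interpreted in `N`: every 2-bounded coloring of pairs has an infinite
rainbow. -/
def RRT22 : Prop :=
  ∀ F ∈ N.S, N.IsColoring F → N.TwoBounded F → ∃ R ∈ N.S, N.IsInfinite R ∧ N.IsRainbow F R

/-- The sentence `WSRRT²₂`, interpreted in `N`: every weakly rainbow-stable 2-bounded coloring of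
pairs has an infinite rainbow. -/
def WSRRT22 : Prop :=
  ∀ F ∈ N.S, N.IsColoring F → N.TwoBounded F → N.WeaklyRainbowStable F →
    ∃ R ∈ N.S, N.IsInfinite R ∧ N.IsRainbow F R

end L2Structure

/-- `φ` implies `ψ` over `RCA₀`: every model of `RCA₀` and `φ` is a model of `ψ` (for sentences of
second order arithmetic this is, by the completeness theorem, `RCA₀ ⊢ φ → ψ`). -/
def ImpliesOverRCA₀ (φ ψ : L2Structure → Prop) : Prop :=
  ∀ N : L2Structure, N.ModelsRCA₀ → φ N → ψ N

end RainbowRamsey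

open RainbowRamsey

-- Part (1) is a bushy tree argument carried out computably in `X'`. In a 2-bounded coloring every
-- number shares its limit color with at most one other number. So if no two elements of a string of
-- length `n` share a limit color (`LimitFree`), then among any `n + 1` numbers at least one can be
-- added while keeping this property (`LimitFree.exists_child`). By weak stability, any sufficiently
-- large such number also keeps the string a rainbow (`RainbowString.eventually`). Hence a tree with
-- at least `c * (n + 1)` children above each inner node of length `n` leaves room for good choices,
-- even when some children have to be avoided.
--
-- To decide whether `e` enters the jump of `R ⊕ X`, maintain a finite rainbow `σ`, a list `E` of
-- indices kept out of the jump, and a constant `c` such that the strings forcing some member of `E`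
-- are not `c`-big above `σ`. If the strings forcing `e` are `(c + 1)`-big above `σ`, a limit-free
-- path through the tree reaches one of them and preserves smallness for `E` (`Big.exists_leaf`).
-- Otherwise, since bigness splits over disjunctions (`Big.or`), adding `e` to `E` preserves
-- smallness with constant `2 * c + 1`. Bigness is `Σ⁰₁` in `X`, and weak stability makes
-- limit-freeness c.e. in `X'`, so the next-state relation is c.e. in `X'`. Uniformizing and
-- iterating it yields an `X'`-computable run that decides the jump.
--
-- For (2), iterate (1) along a sequence that handles every instance computable in an earlier set,
-- and close downward under Turing reducibility. Lowness propagates from each term to the next.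
--
-- For (3), every set of this model is computable in `∅'`. A primitive recursive 2-bounded coloring
-- defeats all such sets: at stage `s` it gives a common color to two apparent elements of the
-- `e`-th candidate, where at most `2 * e` numbers are already taken by earlier candidates. Thus
-- `RRT²₂` fails in the model.

attribute [fun_prop] Primrec PrimrecPred
attribute [fun_prop] Primrec.id Primrec.const Primrec.comp PrimrecPred.not PrimrecPred.and PrimrecPred.or

namespace RainbowRamsey

open Filter

/-! ### Closure properties of primitive recursive functions and predicates. -/

section FunProp

variable {α β γ : Type*} [Primcodable α] [Primcodable β] [Primcodable γ]

@[fun_prop] theorem primrec_pair {f : α → β} {g : α → γ} (hf : Primrec f) (hg : Primrec g) :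
    Primrec fun a => (f a, g a) := hf.pair hg
@[fun_prop] theorem primrec_fst {f : α → β × γ} (hf : Primrec f) : Primrec fun a => (f a).1 :=
  Primrec.fst.comp hf
@[fun_prop] theorem primrec_snd {f : α → β × γ} (hf : Primrec f) : Primrec fun a => (f a).2 :=
  Primrec.snd.comp hf
@[fun_prop] theorem primrec_append {f g : α → List β} (hf : Primrec f) (hg : Primrec g) :
    Primrec fun a => f a ++ g a := Primrec.list_append.comp hf hg
@[fun_prop] theorem primrec_length {f : α → List β} (hf : Primrec f) :
    Primrec fun a => (f a).length := Primrec.list_length.comp hf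
@[fun_prop] theorem primrec_cons {f : α → β} {g : α → List β} (hf : Primrec f) (hg : Primrec g) :
    Primrec fun a => f a :: g a := Primrec.list_cons.comp hf hg
@[fun_prop] theorem primrec_getElem? {f : α → List β} {g : α → ℕ} (hf : Primrec f)
    (hg : Primrec g) : Primrec fun a => (f a)[g a]? := Primrec.list_getElem?.comp hf hg
@[fun_prop] theorem primrec_take {f : α → List β} {g : α → ℕ} (hf : Primrec f)
    (hg : Primrec g) : Primrec fun a => (f a).take (g a) := Primrec.list_take.comp hg hf
@[fun_prop] theorem primrec_add {f g : α → ℕ} (hf : Primrec f) (hg : Primrec g) :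
    Primrec fun a => f a + g a := Primrec.nat_add.comp hf hg
@[fun_prop] theorem primrec_mul {f g : α → ℕ} (hf : Primrec f) (hg : Primrec g) :
    Primrec fun a => f a * g a := Primrec.nat_mul.comp hf hg
@[fun_prop] theorem primrec_natPair {f g : α → ℕ} (hf : Primrec f) (hg : Primrec g) :
    Primrec fun a => Nat.pair (f a) (g a) := Primrec₂.natPair.comp hf hg
@[fun_prop] theorem primrec_unpair {f : α → ℕ} (hf : Primrec f) :
    Primrec fun a => Nat.unpair (f a) := Primrec.unpair.comp hf
@[fun_prop] theorem primrec_some {f : α → β} (hf : Primrec f) :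
    Primrec fun a => some (f a) := Primrec.option_some.comp hf
@[fun_prop] theorem primrec_isSome {f : α → Option β} (hf : Primrec f) :
    Primrec fun a => (f a).isSome := Primrec.option_isSome.comp hf
@[fun_prop] theorem primrec_encode {f : α → β} (hf : Primrec f) :
    Primrec fun a => Encodable.encode (f a) := Primrec.encode.comp hf
@[fun_prop] theorem primrec_decode {f : α → ℕ} (hf : Primrec f) :
    Primrec fun a => (Encodable.decode (f a) : Option β) := Primrec.decode.comp hf
@[fun_prop] theorem primrec_ofNat {δ : Type*} [Denumerable δ] {f : α → ℕ} (hf : Primrec f) :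
    Primrec fun a => Denumerable.ofNat δ (f a) := (Primrec.ofNat δ).comp hf
@[fun_prop] theorem primrec_evaln {k : α → ℕ} {c : α → Nat.Partrec.Code} {n : α → ℕ}
    (hk : Primrec k) (hc : Primrec c) (hn : Primrec n) :
    Primrec fun a => Nat.Partrec.Code.evaln (k a) (c a) (n a) :=
  Nat.Partrec.Code.primrec_evaln.comp ((hk.pair hc).pair hn)

@[fun_prop] theorem primrecPred_eq {f g : α → β} (hf : Primrec f) (hg : Primrec g) :
    PrimrecPred fun a => f a = g a := Primrec.eq.comp hf hg
@[fun_prop] theorem primrecPred_ne {f g : α → β} (hf : Primrec f) (hg : Primrec g) :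
    PrimrecPred fun a => f a ≠ g a := (Primrec.eq.comp hf hg).not
@[fun_prop] theorem primrecPred_lt {f g : α → ℕ} (hf : Primrec f) (hg : Primrec g) :
    PrimrecPred fun a => f a < g a := Primrec.nat_lt.comp hf hg
@[fun_prop] theorem primrecPred_le {f g : α → ℕ} (hf : Primrec f) (hg : Primrec g) :
    PrimrecPred fun a => f a ≤ g a := Primrec.nat_le.comp hf hg
@[fun_prop] theorem primrecPred_mem {f : α → β} {g : α → List β} (hf : Primrec f)
    (hg : Primrec g) : PrimrecPred fun a => f a ∈ g a :=
  (PrimrecRel.comp (PrimrecRel.exists_mem_list Primrec.eq) hg hf).of_eq fun a => by simp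

end FunProp

theorem primrecPred_exists_lt {α : Type*} [Primcodable α] {P : α → ℕ → Prop} {f : α → ℕ}
    (hP : PrimrecPred fun p : α × ℕ => P p.1 p.2) (hf : Primrec f) :
    PrimrecPred fun a => ∃ i < f a, P a i :=
  (PrimrecRel.comp (PrimrecRel.exists_mem_list (R := fun i a => P a i)
    (hP.comp (Primrec.snd.pair Primrec.fst))) (Primrec.list_range.comp hf) Primrec.id).of_eq
    fun a => by simp

theorem primrecPred_forall_lt {α : Type*} [Primcodable α] {P : α → ℕ → Prop} {f : α → ℕ}
    (hP : PrimrecPred fun p : α × ℕ => P p.1 p.2) (hf : Primrec f) :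
    PrimrecPred fun a => ∀ i < f a, P a i :=
  (PrimrecRel.comp (PrimrecRel.forall_mem_list (R := fun i a => P a i)
    (hP.comp (Primrec.snd.pair Primrec.fst))) (Primrec.list_range.comp hf) Primrec.id).of_eq
    fun a => by simp

theorem primrecPred_exists_decode {α β : Type*} [Primcodable α] [Primcodable β]
    {P : α → β → Prop} {f : α → ℕ}
    (hP : PrimrecPred fun p : α × β => P p.1 p.2) (hf : Primrec f) :
    PrimrecPred fun a => ∃ b ∈ (Encodable.decode (f a) : Option β), P a b :=
  (PrimrecRel.comp (PrimrecRel.exists_mem_list (R := fun b a => P a b)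
    (hP.comp (Primrec.snd.pair Primrec.fst)))
    (Primrec.optionToList.comp (Primrec.decode.comp hf)) Primrec.id).of_eq
    fun a => by simp

/-! ### Initial segments -/

theorem length_initSeg (A : Set ℕ) (k : ℕ) : (initSeg A k).length = k := by simp [initSeg]

theorem getElem?_initSeg_eq_true {A : Set ℕ} {k i : ℕ} :
    (initSeg A k)[i]? = some true ↔ i < k ∧ i ∈ A := by
  by_cases h : i < k <;> simp [initSeg, h]

theorem getElem?_initSeg_eq_false {A : Set ℕ} {k i : ℕ} :
    (initSeg A k)[i]? = some false ↔ i < k ∧ i ∉ A := by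
  by_cases h : i < k <;> simp [initSeg, h]

theorem take_initSeg (A : Set ℕ) {j k : ℕ} (h : j ≤ k) :
    (initSeg A k).take j = initSeg A j := by
  simp [initSeg, ← List.map_take, List.take_range, h]

theorem initSeg_prefix (A : Set ℕ) {j k : ℕ} (h : j ≤ k) : initSeg A j <+: initSeg A k := by
  rw [← take_initSeg A h]; exact List.take_prefix _ _

theorem eq_initSeg_iff {A : Set ℕ} {σ : List Bool} {k : ℕ} :
    σ = initSeg A k ↔ σ.length = k ∧ ∀ i < k,
      (σ[i]? = some true ∧ i ∈ A) ∨ (σ[i]? = some false ∧ i ∉ A) := by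
  constructor
  · rintro rfl
    refine ⟨length_initSeg A k, fun i hi => ?_⟩
    rw [getElem?_initSeg_eq_true, getElem?_initSeg_eq_false]
    tauto
  · rintro ⟨h, h'⟩
    refine List.ext_getElem? fun i => ?_
    by_cases hi : i < k
    · rcases h' i hi with ⟨e, hA⟩ | ⟨e, hA⟩
      · rw [e, getElem?_initSeg_eq_true.2 ⟨hi, hA⟩]
      · rw [e, getElem?_initSeg_eq_false.2 ⟨hi, hA⟩]
    · rw [List.getElem?_eq_none (by omega),
        List.getElem?_eq_none (by rw [length_initSeg]; omega)]

theorem initSeg_congr {A B : Set ℕ} {k : ℕ} (h : ∀ i < k, (i ∈ A ↔ i ∈ B)) :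
    initSeg A k = initSeg B k := by
  simp only [initSeg, List.map_inj_left, List.mem_range]
  intro i hi
  simp [h i hi]

/-! ### Predicates computably enumerable in an oracle -/

/-- `P` is computably enumerable in `A`: `P a` is recognised by a primitive recursive test applied
to some initial segment of `A`. -/
def CEIn (A : Set ℕ) {α : Type*} [Primcodable α] (P : α → Prop) : Prop :=
  ∃ Q : List Bool → α → Prop, PrimrecPred (fun p : List Bool × α => Q p.1 p.2) ∧
    (∀ σ τ a, σ <+: τ → Q σ a → Q τ a) ∧ ∀ a, P a ↔ ∃ n, Q (initSeg A n) a

namespace CEIn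

variable {A B : Set ℕ} {α β : Type*} [Primcodable α] [Primcodable β]

theorem of_eq {P Q : α → Prop} (hP : CEIn A P) (h : ∀ a, P a ↔ Q a) : CEIn A Q :=
  (funext fun a => propext (h a) : P = Q) ▸ hP

/-- Removes the monotonicity requirement and allows an extra number witness: the monotone test tries
all prefixes of the given segment and all witnesses below its length. -/
theorem of_exists {P : α → Prop} {Q : List Bool → ℕ → α → Prop}
    (hQ : PrimrecPred fun p : List Bool × ℕ × α => Q p.1 p.2.1 p.2.2)
    (h : ∀ a, P a ↔ ∃ n w, Q (initSeg A n) w a) : CEIn A P := by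
  refine ⟨fun σ a => ∃ k < σ.length + 1, ∃ w < σ.length, Q (σ.take k) w a, ?_, ?_, ?_⟩
  · refine primrecPred_exists_lt (primrecPred_exists_lt ?_ (by fun_prop)) (by fun_prop)
    exact hQ.comp (f := fun p : ((List Bool × α) × ℕ) × ℕ => (p.1.1.1.take p.1.2, p.2, p.1.1.2))
      (by fun_prop)
  · rintro σ τ a hστ ⟨k, hk, w, hw, hq⟩
    have := hστ.length_le
    refine ⟨k, by omega, w, by omega, ?_⟩
    obtain ⟨ρ, rfl⟩ := hστ
    rwa [List.take_append_of_le_length (by omega)]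
  · intro a
    rw [h]
    constructor
    · rintro ⟨n, w, hq⟩
      refine ⟨n + w + 1, n, ?_, w, ?_, ?_⟩
      · rw [length_initSeg]; omega
      · rw [length_initSeg]; omega
      · rwa [take_initSeg _ (by omega)]
    · rintro ⟨n, k, hk, w, hw, hq⟩
      rw [length_initSeg] at hk
      rw [take_initSeg _ (by omega)] at hq
      exact ⟨k, w, hq⟩

theorem prim {P : α → Prop} (hP : PrimrecPred P) : CEIn A P :=
  ⟨fun _ a => P a, hP.comp Primrec.snd, fun _ _ _ _ h => h, fun a => by simp⟩

theorem and {P Q : α → Prop} (hP : CEIn A P) (hQ : CEIn A Q) : CEIn A fun a => P a ∧ Q a := by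
  obtain ⟨P', hP', mP, eP⟩ := hP
  obtain ⟨Q', hQ', mQ, eQ⟩ := hQ
  refine ⟨fun σ a => P' σ a ∧ Q' σ a, hP'.and hQ',
    fun σ τ a h => And.imp (mP σ τ a h) (mQ σ τ a h), fun a => ?_⟩
  simp only [eP, eQ]
  constructor
  · rintro ⟨⟨n, hn⟩, m, hm⟩
    exact ⟨max n m, mP _ _ a (initSeg_prefix A (le_max_left n m)) hn,
      mQ _ _ a (initSeg_prefix A (le_max_right n m)) hm⟩
  · rintro ⟨n, h, h'⟩
    exact ⟨⟨n, h⟩, n, h'⟩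

theorem or {P Q : α → Prop} (hP : CEIn A P) (hQ : CEIn A Q) : CEIn A fun a => P a ∨ Q a := by
  obtain ⟨P', hP', mP, eP⟩ := hP
  obtain ⟨Q', hQ', mQ, eQ⟩ := hQ
  refine ⟨fun σ a => P' σ a ∨ Q' σ a, hP'.or hQ',
    fun σ τ a h => Or.imp (mP σ τ a h) (mQ σ τ a h), fun a => ?_⟩
  simp only [eP, eQ, exists_or]

theorem comp {P : β → Prop} {f : α → β} (hP : CEIn A P) (hf : Primrec f) :
    CEIn A fun a => P (f a) := by
  obtain ⟨P', hP', mP, eP⟩ := hP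
  exact ⟨fun σ a => P' σ (f a),
    hP'.comp (f := fun p : List Bool × α => (p.1, f p.2)) (by fun_prop),
    fun σ τ a h => mP σ τ _ h, fun a => eP _⟩

theorem ex {P : α → β → Prop} (hP : CEIn A fun p : α × β => P p.1 p.2) :
    CEIn A fun a => ∃ b, P a b := by
  obtain ⟨P', hP', mP, eP⟩ := hP
  refine of_exists (Q := fun σ w a => ∃ b ∈ (Encodable.decode w : Option β), P' σ (a, b)) ?_ ?_
  · refine primrecPred_exists_decode ?_ (by fun_prop)
    exact hP'.comp (f := fun p : (List Bool × ℕ × α) × β => (p.1.1, p.1.2.2, p.2)) (by fun_prop)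
  · intro a
    constructor
    · rintro ⟨b, hb⟩
      obtain ⟨n, hn⟩ := (eP (a, b)).1 hb
      exact ⟨n, Encodable.encode b, b, by simp, hn⟩
    · rintro ⟨n, w, b, -, hb⟩
      exact ⟨b, (eP (a, b)).2 ⟨n, hb⟩⟩

theorem forall_lt {P : α → ℕ → Prop} {f : α → ℕ} (hP : CEIn A fun p : α × ℕ => P p.1 p.2)
    (hf : Primrec f) : CEIn A fun a => ∀ i < f a, P a i := by
  obtain ⟨P', hP', mP, eP⟩ := hP
  refine ⟨fun σ a => ∀ i < f a, P' σ (a, i), ?_, ?_, ?_⟩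
  · refine primrecPred_forall_lt ?_ (by fun_prop)
    exact hP'.comp (f := fun p : (List Bool × α) × ℕ => (p.1.1, p.1.2, p.2)) (by fun_prop)
  · exact fun σ τ a h H i hi => mP _ _ _ h (H i hi)
  · intro a
    constructor
    · intro h
      choose! n hn using fun i hi => (eP (a, i)).1 (h i hi)
      refine ⟨(Finset.range (f a)).sup n, fun i hi => mP _ _ _ (initSeg_prefix A ?_) (hn i hi)⟩
      exact Finset.le_sup (f := n) (Finset.mem_range.2 hi)
    · rintro ⟨n, hn⟩ i hi
      exact (eP (a, i)).2 ⟨n, hn i hi⟩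

theorem mem {f : α → ℕ} (hf : Primrec f) : CEIn A fun a => f a ∈ A := by
  refine of_exists (Q := fun σ _ a => σ[f a]? = some true) (by fun_prop) fun a => ?_
  simp only [getElem?_initSeg_eq_true]
  exact ⟨fun h => ⟨f a + 1, 0, by omega, h⟩, fun ⟨_, _, _, h⟩ => h⟩

theorem notMem {f : α → ℕ} (hf : Primrec f) : CEIn A fun a => f a ∉ A := by
  refine of_exists (Q := fun σ _ a => σ[f a]? = some false) (by fun_prop) fun a => ?_
  simp only [getElem?_initSeg_eq_false]
  exact ⟨fun h => ⟨f a + 1, 0, by omega, h⟩, fun ⟨_, _, _, h⟩ => h⟩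

theorem forall_mem {P : α → β → Prop} {L : α → List β} (hP : CEIn A fun p : α × β => P p.1 p.2)
    (hL : Primrec L) : CEIn A fun a => ∀ b ∈ L a, P a b := by
  refine of_eq (P := fun a => ∀ i < (L a).length, ∃ b, (L a)[i]? = some b ∧ P a b) ?_ fun a => ?_
  · refine forall_lt (CEIn.ex ((prim (by fun_prop)).and ?_)) (by fun_prop)
    exact hP.comp (f := fun p : (α × ℕ) × β => (p.1.1, p.2)) (by fun_prop)
  · constructor
    · intro h b hb
      obtain ⟨i, hi⟩ := List.mem_iff_getElem?.1 hb
      obtain ⟨b', hb', hP⟩ := h i (List.getElem?_eq_some_iff.1 hi).1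
      rw [hi] at hb'
      cases hb'
      exact hP
    · intro h i hi
      exact ⟨(L a)[i], by simp [hi], h _ (by simp)⟩

/-- Transitivity of relative computability. -/
theorem trans {P : α → Prop} (hP : CEIn A P) (h1 : CEIn B fun n => n ∈ A)
    (h2 : CEIn B fun n => n ∉ A) : CEIn B P := by
  obtain ⟨Q, hQ, -, eQ⟩ := hP
  -- Guess the segment of `A` that the test reads, and verify it bit by bit from positive and
  -- negative information about `A`.
  refine of_eq (P := fun a => ∃ σ : List Bool, (∀ i < σ.length,
    (σ[i]? = some true ∧ i ∈ A) ∨ (σ[i]? = some false ∧ i ∉ A)) ∧ Q σ a) ?_ fun a => ?_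
  · refine CEIn.ex (CEIn.and (forall_lt (or (and (prim ?_) ?_) (and (prim ?_) ?_)) ?_)
      (prim ?_))
    · fun_prop
    · exact h1.comp (by fun_prop)
    · fun_prop
    · exact h2.comp (by fun_prop)
    · fun_prop
    · exact hQ.comp (f := fun p : α × List Bool => (p.2, p.1)) (by fun_prop)
  · rw [eQ]
    constructor
    · rintro ⟨σ, hσ, hq⟩
      exact ⟨σ.length, (eq_initSeg_iff.2 ⟨rfl, hσ⟩) ▸ hq⟩
    · rintro ⟨n, hq⟩
      refine ⟨_, ?_, hq⟩
      rw [length_initSeg]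
      exact (eq_initSeg_iff.1 rfl).2

theorem ceSet (A : Set ℕ) : CEIn A fun p : ℕ × ℕ => p.2 ∈ ceSet A p.1 := by
  refine of_exists (Q := fun σ w p =>
    ((Denumerable.ofNat Nat.Partrec.Code p.1).evaln w (Encodable.encode (σ, p.2))).isSome = true)
    (by fun_prop) fun p => ?_
  simp only [RainbowRamsey.ceSet, Set.mem_ofPred_eq, Part.dom_iff_mem,
    Nat.Partrec.Code.evaln_complete, Option.isSome_iff_exists, Option.mem_def]
  exact exists_congr fun n => exists_comm

theorem jump (A : Set ℕ) : CEIn A fun e => e ∈ jump A :=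
  (ceSet A).comp (f := fun e : ℕ => (e, e)) (by fun_prop)

/-- The s-m-n theorem for predicates c.e. in `A`. -/
theorem exists_index {P : α → ℕ → Prop} (hP : CEIn A fun p : α × ℕ => P p.1 p.2) :
    ∃ g : α → ℕ, Primrec g ∧ ∀ a n, n ∈ RainbowRamsey.ceSet A (g a) ↔ P a n := by
  obtain ⟨Q, hQ, -, eQ⟩ := hP
  have h1 : REPred fun p : ℕ × ℕ => ∃ b ∈ (Encodable.decode p.2 : Option (List Bool × ℕ)),
        ∃ a ∈ (Encodable.decode p.1 : Option α), Q b.1 (a, b.2) := by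
    refine (primrecPred_exists_decode (primrecPred_exists_decode ?_ (by fun_prop))
      (by fun_prop)).computablePred.to_re
    exact hQ.comp (f := fun p : ((ℕ × ℕ) × List Bool × ℕ) × α => (p.1.2.1, p.2, p.1.2.2))
      (by fun_prop)
  obtain ⟨c, hc⟩ := Nat.Partrec.Code.exists_code.1 h1
  refine ⟨fun a => Encodable.encode (c.curry (Encodable.encode a)), ?_, fun a n => ?_⟩
  · exact Primrec.encode.comp (Nat.Partrec.Code.primrec₂_curry.comp (Primrec.const c)
      Primrec.encode)
  · simp only [RainbowRamsey.ceSet, Set.mem_ofPred_eq, Denumerable.ofNat_encode,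
      Nat.Partrec.Code.eval_curry, hc]
    refine Iff.trans (exists_congr fun k => ?_) (eQ (a, n)).symm
    have : (Encodable.decode (Nat.pair (Encodable.encode a) (Encodable.encode (initSeg A k, n))) :
        Option (ℕ × ℕ)) = some (Encodable.encode a, Encodable.encode (initSeg A k, n)) := by simp
    rw [this]
    simp only [Part.coe_some, Part.bind_some, Encodable.encodek, Part.map_Dom, Part.assert,
      Option.mem_def, Option.some.injEq]
    simp

/-- Every set c.e. in `A` has an index. -/
theorem exists_ceSet_eq {B : Set ℕ} (hB : CEIn A fun n => n ∈ B) :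
    ∃ e, RainbowRamsey.ceSet A e = B := by
  obtain ⟨g, -, hg⟩ := exists_index (α := Unit) (P := fun _ n => n ∈ B)
    (hB.comp Primrec.snd)
  exact ⟨g (), Set.ext (hg ())⟩

/-- Every predicate c.e. in `A` is many-one reducible to the jump of `A`. -/
theorem exists_mem_jump {P : α → Prop} (hP : CEIn A P) :
    ∃ g : α → ℕ, Primrec g ∧ ∀ a, P a ↔ g a ∈ RainbowRamsey.jump A :=
  let ⟨g, hg, h⟩ := exists_index (P := fun a _ => P a) (hP.comp Primrec.fst)
  ⟨g, hg, fun a => (h a _).symm⟩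

theorem to_jump {P : α → Prop} (hP : CEIn A P) : CEIn (RainbowRamsey.jump A) P := by
  obtain ⟨g, hg, h⟩ := hP.exists_mem_jump
  exact (mem hg).of_eq fun a => (h a).symm

theorem not_to_jump {P : α → Prop} (hP : CEIn A P) :
    CEIn (RainbowRamsey.jump A) fun a => ¬ P a := by
  obtain ⟨g, hg, h⟩ := hP.exists_mem_jump
  exact (notMem hg).of_eq fun a => (h a).not.symm

end CEIn

/-! ### Turing reducibility in terms of enumerability (Post's theorem). -/

theorem CEIn.of_recursiveIn {A : Set ℕ} {f : ℕ →. ℕ} (hf : Nat.RecursiveIn {oracle A} f) :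
    CEIn A fun p : ℕ × ℕ => p.2 ∈ f p.1 := by
  induction hf with
  | zero =>
    refine of_eq (P := fun p : ℕ × ℕ => p.2 = 0) (prim (by fun_prop)) fun p => ?_
    exact (Part.mem_some_iff (a := 0) (b := p.2)).symm
  | succ =>
    refine of_eq (P := fun p : ℕ × ℕ => p.2 = p.1 + 1) (prim (by fun_prop)) fun p => ?_
    simp
  | left =>
    refine of_eq (P := fun p : ℕ × ℕ => p.2 = p.1.unpair.1) (prim (by fun_prop)) fun p => ?_
    simp
  | right =>
    refine of_eq (P := fun p : ℕ × ℕ => p.2 = p.1.unpair.2) (prim (by fun_prop)) fun p => ?_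
    simp
  | oracle g hg =>
    obtain rfl := Set.mem_singleton_iff.1 hg
    refine of_eq (P := fun p : ℕ × ℕ => (p.2 = 1 ∧ p.1 ∈ A) ∨ (p.2 = 0 ∧ p.1 ∉ A)) ?_ fun p => ?_
    · exact ((prim (by fun_prop)).and (mem (by fun_prop))).or
        ((prim (by fun_prop)).and (notMem (by fun_prop)))
    · by_cases h : p.1 ∈ A <;> simp [RainbowRamsey.oracle, h]
  | @pair f h _ _ ihf ihh =>
    refine of_eq (P := fun p : ℕ × ℕ => ∃ u v : ℕ, p.2 = Nat.pair u v ∧ u ∈ f p.1 ∧ v ∈ h p.1) ?_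
      fun p => ?_
    · refine CEIn.ex (CEIn.ex ((prim (by fun_prop)).and (and ?_ ?_)))
      · exact ihf.comp (f := fun p : ((ℕ × ℕ) × ℕ) × ℕ => (p.1.1.1, p.1.2)) (by fun_prop)
      · exact ihh.comp (f := fun p : ((ℕ × ℕ) × ℕ) × ℕ => (p.1.1.1, p.2)) (by fun_prop)
    · simp only [Seq.seq, Part.map_eq_map, Part.mem_bind_iff, Part.mem_map_iff]
      constructor
      · rintro ⟨u, v, h, hu, hv⟩
        exact ⟨_, ⟨u, hu, rfl⟩, v, hv, h.symm⟩
      · rintro ⟨_, ⟨u, hu, rfl⟩, v, hv, h⟩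
        exact ⟨u, v, h.symm, hu, hv⟩
  | @comp f h _ _ ihf ihh =>
    refine of_eq (P := fun p : ℕ × ℕ => ∃ u : ℕ, u ∈ h p.1 ∧ p.2 ∈ f u) ?_ fun p => ?_
    · refine CEIn.ex (and ?_ ?_)
      · exact ihh.comp (f := fun p : (ℕ × ℕ) × ℕ => (p.1.1, p.2)) (by fun_prop)
      · exact ihf.comp (f := fun p : (ℕ × ℕ) × ℕ => (p.2, p.1.2)) (by fun_prop)
    · exact Part.mem_bind_iff.symm
  | @prec f h _ _ ihf ihh =>
    -- The witness `L` is the list of all intermediate values of the recursion.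
    refine of_eq (P := fun p : ℕ × ℕ => ∃ L : List ℕ, ∃ u : ℕ, (L[0]? = some u ∧ u ∈ f p.1.unpair.1)
      ∧ (∀ i < p.1.unpair.2, ∃ u : ℕ, ∃ v : ℕ, L[i]? = some u ∧ L[i + 1]? = some v ∧
        v ∈ h (Nat.pair p.1.unpair.1 (Nat.pair i u))) ∧ L[p.1.unpair.2]? = some p.2) ?_ fun p => ?_
    · refine CEIn.ex (CEIn.ex (((prim (by fun_prop)).and ?_).and
        (and (forall_lt (CEIn.ex (CEIn.ex ((prim (by fun_prop)).and
          ((prim (by fun_prop)).and ?_)))) (by fun_prop)) (prim (by fun_prop)))))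
      · exact ihf.comp (f := fun p : ((ℕ × ℕ) × List ℕ) × ℕ => (p.1.1.1.unpair.1, p.2))
          (by fun_prop)
      · exact ihh.comp (f := fun p : (((((ℕ × ℕ) × List ℕ) × ℕ) × ℕ) × ℕ) × ℕ =>
          (Nat.pair p.1.1.1.1.1.1.unpair.1 (Nat.pair p.1.1.2 p.1.2), p.2)) (by fun_prop)
    · obtain ⟨q, m⟩ := p
      simp only
      generalize q.unpair.1 = a
      generalize q.unpair.2 = n
      have key : ∀ n m, (∃ L : List ℕ, ∃ u : ℕ, (L[0]? = some u ∧ u ∈ f a)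
        ∧ (∀ i < n, ∃ u : ℕ, ∃ v : ℕ, L[i]? = some u ∧ L[i + 1]? = some v ∧
        v ∈ h (Nat.pair a (Nat.pair i u))) ∧ L[n]? = some m) ↔
        m ∈ (n.rec (f a) fun y IH => IH >>= fun i => h (Nat.pair a (Nat.pair y i)) : Part ℕ) := by
        intro n
        induction n with
        | zero =>
          intro m
          constructor
          · rintro ⟨L, u, ⟨h0, hu⟩, -, hm⟩
            rw [h0] at hm; cases hm; exact hu
          · intro hm
            exact ⟨[m], m, ⟨rfl, hm⟩, by simp, rfl⟩
        | succ n ih =>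
          intro m
          simp only [Part.bind_eq_bind, Part.mem_bind_iff]
          constructor
          · rintro ⟨L, u, ⟨h0, hu⟩, hL, hm⟩
            obtain ⟨u', v, h1, h2, h3⟩ := hL n (by omega)
            rw [hm] at h2; cases h2
            exact ⟨u', (ih u').1 ⟨L, u, ⟨h0, hu⟩, fun i hi => hL i (by omega), h1⟩, h3⟩
          · rintro ⟨u', hu', h3⟩
            obtain ⟨L, u, ⟨h0, hu⟩, hL, h1⟩ := (ih u').2 hu'
            have hlen : n < L.length := (List.getElem?_eq_some_iff.1 h1).1
            have e : ∀ i ≤ n, (L.take (n + 1) ++ [m])[i]? = L[i]? := by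
              intro i hi
              rw [List.getElem?_append_left (by rw [List.length_take]; omega),
                List.getElem?_take_of_lt (by omega)]
            have e' : (L.take (n + 1) ++ [m])[n + 1]? = some m := by
              rw [List.getElem?_append_right (by rw [List.length_take]; omega), List.length_take,
                min_eq_left (by omega)]
              simp
            refine ⟨L.take (n + 1) ++ [m], u, ⟨(e 0 (by omega)).trans h0, hu⟩, ?_, e'⟩
            intro i hi
            rcases Nat.lt_succ_iff_lt_or_eq.1 hi with hi | rfl
            · rw [e i hi.le, e (i + 1) hi]
              exact hL i hi
            · exact ⟨u', m, (e _ le_rfl).trans h1, e', h3⟩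
      exact key n m
  | @rfind f _ ihf =>
    refine of_eq (P := fun p : ℕ × ℕ => 0 ∈ f (Nat.pair p.1 p.2) ∧ ∀ i < p.2, ∃ m : ℕ, m ≠ 0 ∧
      m ∈ f (Nat.pair p.1 i)) ?_ fun p => ?_
    · refine and ?_ (forall_lt (CEIn.ex ((prim (by fun_prop)).and ?_)) (by fun_prop))
      · exact ihf.comp (f := fun p : ℕ × ℕ => (Nat.pair p.1 p.2, 0)) (by fun_prop)
      · exact ihf.comp (f := fun p : ((ℕ × ℕ) × ℕ) × ℕ => (Nat.pair p.1.1.1 p.1.2, p.2))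
          (by fun_prop)
    · refine Iff.trans ?_ Nat.mem_rfind.symm
      simp only [Part.map_eq_map, Part.mem_map_iff, decide_eq_true_eq,
        decide_eq_false_iff_not, exists_eq_right]
      exact and_congr Iff.rfl (forall_congr' fun i => forall_congr' fun _ =>
        exists_congr fun m => and_comm)

theorem initSeg_succ (A : Set ℕ) (n : ℕ) [Decidable (n ∈ A)] :
    initSeg A (n + 1) = initSeg A n ++ [decide (n ∈ A)] := by
  simp [initSeg, List.range_succ]

theorem recursiveIn_encode_initSeg (B : Set ℕ) : Nat.RecursiveIn {oracle B}
    fun n => Part.some (Encodable.encode (initSeg B n)) := by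
  classical
  let step : ℕ → ℕ := fun m => Encodable.encode
    (((Encodable.decode m.unpair.1 : Option (List Bool)).getD []) ++ [decide (m.unpair.2 = 1)])
  have hstep : Primrec step := by
    refine Primrec.encode.comp (Primrec.list_append.comp (Primrec.option_getD.comp
      (by fun_prop) (by fun_prop)) (Primrec.list_cons.comp ?_ (by fun_prop)))
    exact PrimrecPred.decide (p := fun m : ℕ => m.unpair.2 = 1) (by fun_prop)
  have h1 : Nat.RecursiveIn {oracle B} fun m => Part.some (step m) :=
    Nat.Primrec.recursiveIn (Primrec.nat_iff.1 hstep)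
  have h2 : Nat.RecursiveIn {oracle B} fun _ => Part.some (Encodable.encode ([] : List Bool)) :=
    Nat.Primrec.recursiveIn (Primrec.nat_iff.1 (Primrec.const _))
  have h3 : Nat.RecursiveIn {oracle B} fun n : ℕ => Part.some (Nat.pair 0 n) :=
    Nat.Primrec.recursiveIn (f := fun n => Nat.pair 0 n) (Primrec.nat_iff.1 (by fun_prop))
  have h4 : Nat.RecursiveIn {oracle B} fun n : ℕ => Part.some n.unpair.2.unpair.1 :=
    Nat.Primrec.recursiveIn (f := fun n => n.unpair.2.unpair.1) (Primrec.nat_iff.1 (by fun_prop))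
  have h5 : Nat.RecursiveIn {oracle B} fun n : ℕ => Part.some n.unpair.2.unpair.2 :=
    Nat.Primrec.recursiveIn (f := fun n => n.unpair.2.unpair.2) (Primrec.nat_iff.1 (by fun_prop))
  have h6 : Nat.RecursiveIn {oracle B} (oracle B) := .oracle _ rfl
  refine ((h2.prec (h1.comp (h5.pair (h6.comp h4)))).comp h3).of_eq fun n => ?_
  simp only [Part.bind_eq_bind, Part.bind_some, Nat.unpair_pair]
  induction n with
  | zero => simp [initSeg]
  | succ n ih =>
    change Part.bind _ _ = _
    rw [ih]
    have hB : (Part.some n >>= oracle B) = Part.some (if n ∈ B then 1 else 0) := by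
      refine (Part.bind_some n (oracle B)).trans ?_
      simp only [oracle]
    rw [hB, initSeg_succ]
    by_cases h : n ∈ B <;> simp [step, h, Seq.seq]

/-- For the converse, search for an initial segment of `B` accepted by the test for `A` or by the
test for its complement. Exactly one of the two tests ever accepts, so the first success gives the
answer. -/
theorem turingLE_iff {A B : Set ℕ} :
    TuringLE A B ↔ CEIn B (fun n => n ∈ A) ∧ CEIn B (fun n => n ∉ A) := by
  classical
  constructor
  · intro h
    have := CEIn.of_recursiveIn (RecursiveIn.iff_nat.1 h)
    refine ⟨(this.comp (f := fun n => (n, 1)) (by fun_prop)).of_eq fun n => ?_,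
      (this.comp (f := fun n => (n, 0)) (by fun_prop)).of_eq fun n => ?_⟩ <;>
    by_cases h : n ∈ A <;> simp [oracle, h]
  · rintro ⟨⟨P, hP, -, eP⟩, ⟨Q, hQ, -, eQ⟩⟩
    refine RecursiveIn.iff_nat.2 ?_
    let dec : ℕ → List Bool := fun m => (Encodable.decode m : Option (List Bool)).getD []
    have hdec : Primrec dec := Primrec.option_getD.comp (by fun_prop) (by fun_prop)
    let t : ℕ → ℕ := fun m => if P (dec m.unpair.2) m.unpair.1 then 1 else 0
    -- Success is coded by `0` because `rfind` looks for a zero.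
    let u : ℕ → ℕ := fun m => if P (dec m.unpair.2) m.unpair.1 ∨ Q (dec m.unpair.2) m.unpair.1
      then 0 else 1
    have hP' : PrimrecPred fun m : ℕ => P (dec m.unpair.2) m.unpair.1 :=
      hP.comp (f := fun m : ℕ => (dec m.unpair.2, m.unpair.1)) (by fun_prop)
    have hQ' : PrimrecPred fun m : ℕ => Q (dec m.unpair.2) m.unpair.1 :=
      hQ.comp (f := fun m : ℕ => (dec m.unpair.2, m.unpair.1)) (by fun_prop)
    have ht : Nat.RecursiveIn {oracle B} fun n => Part.some (t n) :=
      Nat.Primrec.recursiveIn (Primrec.nat_iff.1 (Primrec.ite hP' (by fun_prop) (by fun_prop)))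
    have hu : Nat.RecursiveIn {oracle B} fun n => Part.some (u n) :=
      Nat.Primrec.recursiveIn (Primrec.nat_iff.1
        (Primrec.ite (hP'.or hQ') (by fun_prop) (by fun_prop)))
    have hc := recursiveIn_encode_initSeg B
    have hid : Nat.RecursiveIn {oracle B} fun n : ℕ => Part.some n :=
      Nat.Primrec.recursiveIn (f := fun n => n) (Primrec.nat_iff.1 (by fun_prop))
    have hl : Nat.RecursiveIn {oracle B} fun n : ℕ => Part.some n.unpair.1 := .left
    have hr : Nat.RecursiveIn {oracle B} fun n : ℕ => Part.some n.unpair.2 := .right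
    have hsearch := Nat.RecursiveIn.rfind (hu.comp (hl.pair (hc.comp hr)))
    refine (ht.comp (hid.pair (hc.comp hsearch))).of_eq_tot
      (g := fun n => if n ∈ A then 1 else 0) fun x => ?_
    have hd : ∀ n, dec (Encodable.encode (initSeg B n)) = initSeg B n := fun n => by simp [dec]
    have hx : ∃ n, P (initSeg B n) x ∨ Q (initSeg B n) x := by
      by_cases h : x ∈ A
      · obtain ⟨n, hn⟩ := (eP x).1 h
        exact ⟨n, Or.inl hn⟩
      · obtain ⟨n, hn⟩ := (eQ x).1 h
        exact ⟨n, Or.inr hn⟩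
    have hfind : Nat.find hx ∈ Nat.rfind fun n => (Part.some (decide
        (u (Nat.pair x (Encodable.encode (initSeg B n))) = 0)) : Part Bool) := by
      refine Nat.mem_rfind.2 ⟨?_, fun {m} hm => ?_⟩
      · have := Nat.find_spec hx
        simp [u, hd, this]
      · have := Nat.find_min hx hm
        simp [u, hd, this]
    have hsp := Nat.find_spec hx
    simp only [Part.bind_eq_bind, Part.bind_some, Nat.unpair_pair, Part.map_eq_map, Part.map_some,
      Seq.seq]
    rw [Part.eq_some_iff.2 hfind]
    simp only [Part.bind_some, Part.map_some, t, Nat.unpair_pair, hd, Part.mem_some_iff]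
    by_cases h : x ∈ A
    · have : ¬ Q (initSeg B (Nat.find hx)) x := fun h' => (eQ x).2 ⟨_, h'⟩ h
      simp [h, hsp.resolve_right this]
    · have : ¬ P (initSeg B (Nat.find hx)) x := fun h' => h ((eP x).2 ⟨_, h'⟩)
      simp [h, this]

theorem ColoringComputableIn.ceIn {X : Set ℕ} {F : ℕ × ℕ → ℕ} (hF : ComputableIn {oracle X} F) :
    CEIn X fun p : (ℕ × ℕ) × ℕ => F p.1 = p.2 := by
  refine ((CEIn.of_recursiveIn hF).comp
    (f := fun p : (ℕ × ℕ) × ℕ => (Encodable.encode p.1, p.2)) (by fun_prop)).of_eq fun p => ?_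
  simp only [Encodable.encodek, Part.coe_some, Part.bind_some, Part.map_some, Part.mem_some_iff]
  exact eq_comm

theorem TuringLE.ceIn {A B : Set ℕ} (h : TuringLE A B) {α : Type*} [Primcodable α] {P : α → Prop}
    (hP : CEIn A P) : CEIn B P :=
  hP.trans (turingLE_iff.1 h).1 (turingLE_iff.1 h).2

theorem TuringLE.refl (A : Set ℕ) : TuringLE A A := TuringReducible.refl _

theorem TuringLE.trans {A B C : Set ℕ} (h : TuringLE A B) (h' : TuringLE B C) : TuringLE A C :=
  TuringReducible.trans h h'

theorem turingLE_jump_of_ceIn {A B : Set ℕ} (h : CEIn B fun n => n ∈ A) : TuringLE A (jump B) :=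
  turingLE_iff.2 ⟨h.to_jump, h.not_to_jump⟩

theorem TuringLE.le_jump {A B : Set ℕ} (h : TuringLE A B) : TuringLE A (jump B) :=
  turingLE_jump_of_ceIn (turingLE_iff.1 h).1

theorem TuringLE.jump {A B : Set ℕ} (h : TuringLE A B) : TuringLE (jump A) (jump B) :=
  turingLE_jump_of_ceIn (h.ceIn (CEIn.jump A))

/-! ### Uniformization and effective iteration of c.e. relations. -/

namespace CEIn

variable {A : Set ℕ} {α β : Type*} [Primcodable α] [Primcodable β]

theorem eq_initSeg (A : Set ℕ) : CEIn A fun p : List Bool × ℕ => p.1 = initSeg A p.2 := by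
  refine of_eq (P := fun p : List Bool × ℕ => p.1.length = p.2 ∧ ∀ i < p.2,
      (p.1[i]? = some true ∧ i ∈ A) ∨ (p.1[i]? = some false ∧ i ∉ A)) ?_
    fun p => eq_initSeg_iff.symm
  exact (prim (by fun_prop)).and (forall_lt (((prim (by fun_prop)).and (mem (by fun_prop))).or
    ((prim (by fun_prop)).and (notMem (by fun_prop)))) (by fun_prop))

/-- Uniformization of c.e. relations. -/
theorem exists_uniformization {R : α → β → Prop} (hR : CEIn A fun p : α × β => R p.1 p.2) :
    ∃ G : α → β → Prop, (CEIn A fun p : α × β => G p.1 p.2) ∧ (∀ a b, G a b → R a b) ∧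
      (∀ a b b', G a b → G a b' → b = b') ∧ ∀ a b, R a b → ∃ b', G a b' := by
  classical
  obtain ⟨Q, hQ, -, eQ⟩ := hR
  let D : List Bool → α → ℕ → Prop := fun σ a w =>
    ∃ b ∈ (Encodable.decode w.unpair.2 : Option β), Q σ (a, b)
  have hD : PrimrecPred fun p : (List Bool × α) × ℕ => D p.1.1 p.1.2 p.2 := by
    refine primrecPred_exists_decode ?_ (by fun_prop)
    exact hQ.comp (f := fun p : ((List Bool × α) × ℕ) × β => (p.1.1.1, p.1.1.2, p.2)) (by fun_prop)
  -- The number `w` codes both a length of segment and a candidate value. With the length fixed, `T`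
  -- is decidable in `A`, so selecting the least `w` remains c.e. in `A`.
  let T : α → ℕ → Prop := fun a w => D (initSeg A w.unpair.1) a w
  have hT : CEIn A fun p : α × ℕ => T p.1 p.2 := by
    refine of_eq (P := fun p : α × ℕ => ∃ σ, σ = initSeg A p.2.unpair.1 ∧ D σ p.1 p.2) ?_
      fun p => by simp [T]
    refine CEIn.ex (and ?_ (prim ?_))
    · exact (eq_initSeg A).comp (f := fun p : (α × ℕ) × List Bool => (p.2, p.1.2.unpair.1))
        (by fun_prop)
    · exact hD.comp (f := fun p : (α × ℕ) × List Bool => ((p.2, p.1.1), p.1.2)) (by fun_prop)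
  have hT' : CEIn A fun p : α × ℕ => ¬ T p.1 p.2 := by
    refine of_eq (P := fun p : α × ℕ => ∃ σ, σ = initSeg A p.2.unpair.1 ∧ ¬ D σ p.1 p.2) ?_
      fun p => by simp [T]
    refine CEIn.ex (and ?_ (prim (PrimrecPred.not ?_)))
    · exact (eq_initSeg A).comp (f := fun p : (α × ℕ) × List Bool => (p.2, p.1.2.unpair.1))
        (by fun_prop)
    · exact hD.comp (f := fun p : (α × ℕ) × List Bool => ((p.2, p.1.1), p.1.2)) (by fun_prop)
  refine ⟨fun a b => ∃ w : ℕ, (Encodable.decode w.unpair.2 : Option β) = some b ∧ T a w ∧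
    ∀ v < w, ¬ T a v, ?_, ?_, ?_, ?_⟩
  · refine CEIn.ex ((prim (by fun_prop)).and (and ?_ (forall_lt ?_ (by fun_prop))))
    · exact hT.comp (f := fun p : (α × β) × ℕ => (p.1.1, p.2)) (by fun_prop)
    · exact hT'.comp (f := fun p : ((α × β) × ℕ) × ℕ => (p.1.1.1, p.2)) (by fun_prop)
  · rintro a b ⟨w, hw, ⟨b', hb', hq⟩, -⟩
    rw [Option.mem_def, hw] at hb'
    cases hb'
    exact (eQ (a, b)).2 ⟨_, hq⟩
  · rintro a b b' ⟨w, hw, h1, h2⟩ ⟨w', hw', h1', h2'⟩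
    obtain rfl : w = w' := by
      rcases lt_trichotomy w w' with h | h | h
      · exact absurd h1 (h2' w h)
      · exact h
      · exact absurd h1' (h2 w' h)
    rw [hw] at hw'
    exact Option.some.inj hw'
  · intro a b hab
    obtain ⟨n, hn⟩ := (eQ (a, b)).1 hab
    have hex : ∃ w, T a w := ⟨Nat.pair n (Encodable.encode b), b, by simp, by simpa using hn⟩
    obtain ⟨b', hb', -⟩ := id (Nat.find_spec hex)
    exact ⟨b', Nat.find hex, hb', Nat.find_spec hex, fun v hv => Nat.find_min hex hv⟩

/-- A relation c.e. in `A` can be iterated by a sequence computable in `A`. -/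
theorem exists_sequence {R : β → β → Prop} (hR : CEIn A fun p : β × β => R p.1 p.2)
    {I : β → Prop} {x₀ : β} (h₀ : I x₀) (hI : ∀ x y, I x → R x y → I y)
    (hR' : ∀ x, I x → ∃ y, R x y) :
    ∃ s : ℕ → β, s 0 = x₀ ∧ (∀ n, I (s n)) ∧ (∀ n, R (s n) (s (n + 1))) ∧
      CEIn A fun p : ℕ × β => s p.1 = p.2 := by
  obtain ⟨G, hG, hGR, huniq, htot⟩ := hR.exists_uniformization
  choose! g hg using fun x (hx : I x) => (hR' x hx).elim (htot x)
  let s : ℕ → β := fun n => g^[n] x₀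
  have hs : ∀ n, s (n + 1) = g (s n) := fun n => Function.iterate_succ_apply' g n x₀
  have hIs : ∀ n, I (s n) := by
    intro n
    induction n with
    | zero => exact h₀
    | succ n ih => rw [hs]; exact hI _ _ ih (hGR _ _ (hg _ ih))
  have hGs : ∀ n, G (s n) (s (n + 1)) := fun n => by rw [hs]; exact hg _ (hIs n)
  refine ⟨s, rfl, hIs, fun n => hGR _ _ (hGs n), ?_⟩
  -- Since `G` is single-valued, a finite `G`-chain from `x₀` must be an initial part of `s`. The
  -- invariant `I` needs no effectivity: it only ensures that the chain never gets stuck.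
  refine of_eq (P := fun p : ℕ × β => ∃ L : List β, L[0]? = some x₀ ∧ (∀ i < p.1, ∃ u : β, ∃ v : β,
    L[i]? = some u ∧ L[i + 1]? = some v ∧ G u v) ∧ L[p.1]? = some p.2) ?_ fun p => ?_
  · refine CEIn.ex ((prim (by fun_prop)).and (and (forall_lt (CEIn.ex (CEIn.ex
      ((prim (by fun_prop)).and ((prim (by fun_prop)).and ?_)))) (by fun_prop))
      (prim (by fun_prop))))
    exact hG.comp (f := fun p : ((((ℕ × β) × List β) × ℕ) × β) × β => (p.1.2, p.2))
      (by fun_prop)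
  · obtain ⟨n, b⟩ := p
    constructor
    · rintro ⟨L, h0, hL, hn⟩
      have : ∀ i ≤ n, L[i]? = some (s i) := by
        intro i
        induction i with
        | zero => exact fun _ => h0
        | succ i ih =>
          intro hi
          obtain ⟨u, v, hu, hv, huv⟩ := hL i hi
          rw [ih (by omega)] at hu
          cases hu
          rw [hv, huniq _ _ _ huv (hGs i)]
      have h' := this n le_rfl
      exact Option.some.inj (h'.symm.trans hn)
    · intro h
      replace h : s n = b := h
      subst h
      have e : ∀ i ≤ n, ((List.range (n + 1)).map s)[i]? = some (s i) := by
        intro i hi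
        rw [List.getElem?_map, List.getElem?_range (by omega)]
        rfl
      exact ⟨(List.range (n + 1)).map s, e 0 (by omega), fun i hi => ⟨s i, s (i + 1), e i hi.le,
        e (i + 1) hi, hGs i⟩, e n le_rfl⟩

end CEIn

/-! ### Bushy trees

Strings are lists of natural numbers, extended at the head. -/

/-- `B` is `c`-big above `σ`: some finite tree with root `σ`, whose leaves are in `B`, has at least
`c * (|τ| + 1)` children above each node `τ` that is not a leaf. -/
def Big (c : ℕ) (B : List ℕ → Prop) (σ : List ℕ) : Prop :=
  ∃ L : List (List ℕ), σ ∈ L ∧ ∀ τ ∈ L, B τ ∨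
    ∃ l : List ℕ, l.Nodup ∧ c * (τ.length + 1) ≤ l.length ∧ ∀ s ∈ l, s :: τ ∈ L

namespace Big

variable {c d : ℕ} {B C : List ℕ → Prop} {σ : List ℕ}

theorem leaf (h : B σ) : Big c B σ := ⟨[σ], by simp, by simp [h]⟩

theorem node {l : List ℕ} (hl : l.Nodup) (hc : c * (σ.length + 1) ≤ l.length)
    (h : ∀ s ∈ l, Big c B (s :: σ)) : Big c B σ := by
  choose! L hL hB using h
  refine ⟨σ :: l.flatMap L, by simp, fun τ hτ => ?_⟩
  rcases List.mem_cons.1 hτ with rfl | hτ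
  · exact Or.inr ⟨l, hl, hc, fun s hs =>
      List.mem_cons_of_mem _ (List.mem_flatMap.2 ⟨s, hs, hL s hs⟩)⟩
  · obtain ⟨s, hs, hτ⟩ := List.mem_flatMap.1 hτ
    refine (hB s hs τ hτ).imp_right ?_
    rintro ⟨l', h1, h2, h3⟩
    exact ⟨l', h1, h2, fun x hx => List.mem_cons_of_mem _ (List.mem_flatMap.2 ⟨s, hs, h3 x hx⟩)⟩

/-- The list witnessing bigness is finite and children are longer than their parents, so induction
on the distance to the maximal length goes from the leaves down to the root. -/
theorem rec_on {M : List ℕ → Prop} (h : Big c B σ) (hleaf : ∀ τ, B τ → M τ)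
    (hnode : ∀ τ l, List.Nodup l → c * (τ.length + 1) ≤ l.length → (∀ s ∈ l, M (s :: τ)) → M τ) :
    M σ := by
  obtain ⟨L, hσ, hL⟩ := h
  obtain ⟨N, hN⟩ : ∃ N, ∀ τ ∈ L, τ.length ≤ N :=
    ⟨(L.map List.length).sum, fun τ hτ => List.single_le_sum (by simp) _
      (List.mem_map_of_mem hτ)⟩
  have : ∀ k, ∀ τ ∈ L, N + 1 ≤ τ.length + k → M τ := by
    intro k
    induction k with
    | zero => intro τ hτ h; have := hN τ hτ; omega
    | succ k ih =>
      intro τ hτ hk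
      rcases hL τ hτ with h | ⟨l, h1, h2, h3⟩
      · exact hleaf τ h
      · exact hnode τ l h1 h2 fun s hs => ih _ (h3 s hs) (by simp only [List.length_cons]; omega)
  exact this (N + 1) σ hσ (by omega)

/-- Induct from the leaves. At an inner node of length `n`, either `c * (n + 1)` children are
`c`-big for `B`, or the remaining ones, at least `d * (n + 1)` in number, are `d`-big for `C`. -/
theorem or (h : Big (c + d) (fun τ => B τ ∨ C τ) σ) : Big c B σ ∨ Big d C σ := by
  classical
  refine h.rec_on (M := fun τ => Big c B τ ∨ Big d C τ) (fun τ => Or.imp leaf leaf)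
    fun τ l hl hc hs => ?_
  by_cases h : c * (τ.length + 1) ≤ (l.filter fun s => Big c B (s :: τ)).length
  · exact Or.inl (node (hl.filter _) h fun s hs => by simpa using (List.mem_filter.1 hs).2)
  · refine Or.inr (node (l := l.filter fun s => ¬ Big c B (s :: τ)) (hl.filter _) ?_ fun s hs' => ?_)
    · have := List.length_eq_length_filter_add (l := l) fun s => decide (Big c B (s :: τ))
      rw [add_mul] at hc
      simp only [decide_not]
      omega
    · have := List.mem_filter.1 hs'
      exact (hs s this.1).resolve_left (by simpa using this.2)

/-- Fewer than `c * (n + 1)` of the children can be `c`-big, as otherwise `σ` would be. At least `n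
+ 1` others remain, which suffices to find one with `P`. -/
theorem exists_child {P : List ℕ → Prop} (hP : ∀ l : List ℕ, l.Nodup → σ.length + 1 ≤ l.length →
    ∃ s ∈ l, P (s :: σ)) (hB : ¬ Big c B σ) {l : List ℕ} (hl : l.Nodup)
    (hc : (c + 1) * (σ.length + 1) ≤ l.length) : ∃ s ∈ l, P (s :: σ) ∧ ¬ Big c B (s :: σ) := by
  classical
  have h1 : ¬ c * (σ.length + 1) ≤ (l.filter fun s => Big c B (s :: σ)).length := fun h =>
    hB (node (hl.filter _) h fun s hs => by simpa using (List.mem_filter.1 hs).2)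
  have h2 := List.length_eq_length_filter_add (l := l) fun s => decide (Big c B (s :: σ))
  obtain ⟨s, hs, hPs⟩ := hP (l.filter fun s => ¬ Big c B (s :: σ)) (hl.filter _) (by
    rw [add_mul] at hc
    simp only [decide_not]
    omega)
  have := List.mem_filter.1 hs
  exact ⟨s, this.1, hPs, by simpa using this.2⟩

/-- Climb the tree from its root: its branching, with one unit more than `c`, always offers a child
with `P` above which `B` is still not `c`-big. -/
theorem exists_leaf {P : List ℕ → Prop} (hP : ∀ τ, P τ → ∀ l : List ℕ, l.Nodup →
    τ.length + 1 ≤ l.length → ∃ s ∈ l, P (s :: τ)) (hC : Big (c + 1) C σ) (hB : ¬ Big c B σ)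
    (hσ : P σ) : ∃ τ, σ <:+ τ ∧ C τ ∧ P τ ∧ ¬ Big c B τ := by
  refine hC.rec_on (M := fun τ => P τ → ¬ Big c B τ → ∃ ρ, τ <:+ ρ ∧ C ρ ∧ P ρ ∧ ¬ Big c B ρ)
    (fun τ h h' h'' => ⟨τ, List.suffix_rfl, h, h', h''⟩) ?_ hσ hB
  intro τ l hl hc ih hPτ hBτ
  obtain ⟨s, hs, hPs, hBs⟩ := exists_child (hP τ hPτ) hBτ hl hc
  obtain ⟨ρ, h, h'⟩ := ih s hs hPs hBs
  exact ⟨ρ, (List.suffix_cons s τ).trans h, h'⟩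

/-- For `c = 0` this would fail, since a node with no children would count as an inner node. -/
theorem not_of_no_leaf (hc : 1 ≤ c) (hB : ∀ τ, ¬ B τ) : ¬ Big c B σ := fun h =>
  h.rec_on (M := fun _ => False) hB fun τ l _ hl ih => by
    obtain ⟨s, hs⟩ := List.exists_mem_of_length_pos (l := l)
      ((Nat.mul_pos hc (Nat.succ_pos _)).trans_le hl)
    exact ih s hs

end Big

/-- This is why trees are coded by finite lists: bigness becomes one existential quantifier over a
condition c.e. in `X`. -/
theorem CEIn.big {X : Set ℕ} {α : Type*} [Primcodable α] {B : α → List ℕ → Prop}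
    (hB : CEIn X fun p : α × List ℕ => B p.1 p.2) :
    CEIn X fun p : (α × ℕ) × List ℕ => Big p.1.2 (B p.1.1) p.2 := by
  refine of_eq (P := fun p : (α × ℕ) × List ℕ => ∃ L : List (List ℕ), p.2 ∈ L ∧ ∀ τ ∈ L,
    B p.1.1 τ ∨ ∃ l : List ℕ, (∀ i < l.length, ∀ j < l.length, i = j ∨ l[i]? ≠ l[j]?) ∧
      p.1.2 * (τ.length + 1) ≤ l.length ∧ ∀ s ∈ l, s :: τ ∈ L) ?_ fun p => ?_
  · refine CEIn.ex ((prim (by fun_prop)).and (forall_mem (or ?_ (CEIn.ex (and ?_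
      ((prim (by fun_prop)).and (forall_mem (prim (by fun_prop)) (by fun_prop)))))) (by fun_prop)))
    · exact hB.comp (f := fun p : (((α × ℕ) × List ℕ) × List (List ℕ)) × List ℕ =>
        (p.1.1.1.1, p.2)) (by fun_prop)
    · exact forall_lt (forall_lt (prim (by fun_prop)) (by fun_prop)) (by fun_prop)
  · refine exists_congr fun L => and_congr Iff.rfl (forall_congr' fun τ => forall_congr' fun _ =>
      or_congr Iff.rfl (exists_congr fun l => and_congr ?_ Iff.rfl))
    rw [List.nodup_iff_injective_getElem]
    constructor
    · intro h i j hij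
      rcases h i i.2 j j.2 with e | e
      · exact Fin.ext e
      · exact absurd (by simpa using hij) e
    · intro h i hi j hj
      by_contra! hne
      refine hne.1 (congrArg Fin.val (@h ⟨i, hi⟩ ⟨j, hj⟩ ?_))
      simpa [hi, hj] using hne.2

/-! ### Elementary reformulations of rainbows, 2-boundedness and joins. -/

theorem isRainbow_iff {f : ℕ → ℕ → ℕ} {R : Set ℕ} : IsRainbow f R ↔ ∀ x₁ ∈ R, ∀ y₁ ∈ R,
    ∀ x₂ ∈ R, ∀ y₂ ∈ R, x₁ < y₁ → x₂ < y₂ → f x₁ y₁ = f x₂ y₂ → x₁ = x₂ ∧ y₁ = y₂ := by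
  constructor
  · intro h x₁ hx₁ y₁ hy₁ x₂ hx₂ y₂ hy₂ h₁ h₂ e
    have := @h (x₁, y₁) ⟨hx₁, hy₁, h₁⟩ (x₂, y₂) ⟨hx₂, hy₂, h₂⟩ e
    simpa using this
  · rintro h ⟨x₁, y₁⟩ ⟨hx₁, hy₁, h₁⟩ ⟨x₂, y₂⟩ ⟨hx₂, hy₂, h₂⟩ e
    obtain ⟨rfl, rfl⟩ := h x₁ hx₁ y₁ hy₁ x₂ hx₂ y₂ hy₂ h₁ h₂ e
    rfl

theorem twoBounded_iff {f : ℕ → ℕ → ℕ} : TwoBounded f ↔ ∀ p q r : ℕ × ℕ, p.1 < p.2 → q.1 < q.2 →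
    r.1 < r.2 → f p.1 p.2 = f q.1 q.2 → f p.1 p.2 = f r.1 r.2 → p = q ∨ p = r ∨ q = r := by
  constructor
  · intro h p q r hp hq hr h1 h2
    by_contra! hne
    have := h (f p.1 p.2)
    have h3 : ({p, q, r} : Set (ℕ × ℕ)).encard ≤ 2 := by
      refine (Set.encard_le_encard ?_).trans this
      rintro s (rfl | rfl | rfl)
      · exact ⟨hp, rfl⟩
      · exact ⟨hq, h1.symm⟩
      · exact ⟨hr, h2.symm⟩
    rw [Set.encard_eq_three.2 ⟨p, q, r, hne.1, hne.2.1, hne.2.2, rfl⟩] at h3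
    exact absurd h3 (by decide)
  · intro h c
    by_contra! hc
    obtain ⟨t, ht, h3⟩ := Set.exists_subset_encard_eq (k := 3) (Order.add_one_le_of_lt hc)
    obtain ⟨p, q, r, h1, h2, h4, rfl⟩ := Set.encard_eq_three.1 h3
    obtain ⟨hp, hpc⟩ := ht (by simp : p ∈ _)
    obtain ⟨hq, hqc⟩ := ht (by simp : q ∈ _)
    obtain ⟨hr, hrc⟩ := ht (by simp : r ∈ _)
    rcases h p q r hp hq hr (hpc.trans hqc.symm) (hpc.trans hrc.symm) with e | e | e
    exacts [h1 e, h2 e, h4 e]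

theorem mem_join {A B : Set ℕ} {i : ℕ} : i ∈ join A B ↔
    ∃ a, (i = 2 * a ∧ a ∈ A) ∨ (i = 2 * a + 1 ∧ a ∈ B) := by
  simp only [join, Set.mem_ofPred_eq]
  constructor
  · rintro (⟨a, h, e⟩ | ⟨a, h, e⟩)
    exacts [⟨a, Or.inl ⟨e, h⟩⟩, ⟨a, Or.inr ⟨e, h⟩⟩]
  · rintro ⟨a, ⟨e, h⟩ | ⟨e, h⟩⟩
    exacts [Or.inl ⟨a, h, e⟩, Or.inr ⟨a, h, e⟩]

theorem notMem_join {A B : Set ℕ} {i : ℕ} : i ∉ join A B ↔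
    ∃ a, (i = 2 * a ∧ a ∉ A) ∨ (i = 2 * a + 1 ∧ a ∉ B) := by
  rw [mem_join]
  constructor
  · intro h
    obtain ⟨a, e | e⟩ := i.even_or_odd'
    · exact ⟨a, Or.inl ⟨e, fun h' => h ⟨a, Or.inl ⟨e, h'⟩⟩⟩⟩
    · exact ⟨a, Or.inr ⟨e, fun h' => h ⟨a, Or.inr ⟨e, h'⟩⟩⟩⟩
  · rintro ⟨a, ⟨e, h⟩ | ⟨e, h⟩⟩ ⟨b, ⟨e', h'⟩ | ⟨e', h'⟩⟩
    · obtain rfl : a = b := by omega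
      exact h h'
    · omega
    · omega
    · obtain rfl : a = b := by omega
      exact h h'

/-- `x` and `y` have the same color in the limit. -/
def LimitEq (f : ℕ → ℕ → ℕ) (x y : ℕ) : Prop := ∀ᶠ s in atTop, f x s = f y s

/-- No two distinct elements of `τ` have the same color in the limit. -/
def LimitFree (f : ℕ → ℕ → ℕ) (τ : List ℕ) : Prop := ∀ x ∈ τ, ∀ y ∈ τ, x = y ∨ ¬ LimitEq f x y

/-- `τ` lists a finite rainbow in decreasing order. -/
def RainbowString (f : ℕ → ℕ → ℕ) (τ : List ℕ) : Prop :=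
  τ.Pairwise (· > ·) ∧ IsRainbow f {x | x ∈ τ}

/-- The finite rainbow `τ` forces `e` into the jump of the join with `X`. -/
def Forces (f : ℕ → ℕ → ℕ) (X : Set ℕ) (e : ℕ) (τ : List ℕ) : Prop :=
  RainbowString f τ ∧ ∃ m ∈ τ, ∃ k ≤ 2 * m, ((Denumerable.ofNat Nat.Partrec.Code e).eval
    (Encodable.encode (initSeg (join {x | x ∈ τ} X) k, e))).Dom

/-! ### Limit colors and one-step extensions of finite rainbows. -/

section Combinatorics

variable {f : ℕ → ℕ → ℕ} {X : Set ℕ} {σ τ : List ℕ}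

theorem LimitEq.symm {x y : ℕ} (h : LimitEq f x y) : LimitEq f y x :=
  Eventually.mono h fun _ => Eq.symm

/-- Otherwise, for large `s`, the three pairs `(x, s)`, `(y, s)`, `(z, s)` would share a color. -/
theorem LimitEq.unique (hf : TwoBounded f) {x y z : ℕ} (hy : LimitEq f x y) (hz : LimitEq f x z)
    (hxy : x ≠ y) (hxz : x ≠ z) : y = z := by
  obtain ⟨s, h1, h2, hx, hy, hz⟩ := (hy.and (hz.and ((eventually_gt_atTop x).and
    ((eventually_gt_atTop y).and (eventually_gt_atTop z))))).exists
  rcases twoBounded_iff.1 hf (x, s) (y, s) (z, s) hx hy hz h1 h2 with e | e | e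
  · exact absurd (congrArg Prod.fst e) hxy
  · exact absurd (congrArg Prod.fst e) hxz
  · exact congrArg Prod.fst e

/-- If every `s` in `l` failed, each would have a limit partner in `τ`. Partners are unique, so this
would inject `l` into the shorter list `τ`. -/
theorem LimitFree.exists_child (hf : TwoBounded f) (hτ : LimitFree f τ) {l : List ℕ}
    (hl : l.Nodup) (hlen : τ.length + 1 ≤ l.length) : ∃ s ∈ l, LimitFree f (s :: τ) := by
  by_contra! hcon
  have key : ∀ s ∈ l, ∃ x ∈ τ, x ≠ s ∧ LimitEq f x s := by
    intro s hs
    by_contra! h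
    refine hcon s hs ?_
    intro x hx y hy
    rcases List.mem_cons.1 hx with rfl | hx' <;> rcases List.mem_cons.1 hy with rfl | hy'
    · exact Or.inl rfl
    · by_cases e : y = x
      · exact Or.inl e.symm
      · exact Or.inr fun hl => h y hy' e hl.symm
    · by_cases e : x = y
      · exact Or.inl e
      · exact Or.inr (h x hx' e)
    · exact hτ x hx' y hy'
  choose! p hp hps hpl using key
  have hsub : l.toFinset.card ≤ τ.toFinset.card := by
    refine Finset.card_le_card_of_injOn p (fun s hs => ?_) fun s hs t ht e => ?_
    · simpa using hp s (by simpa using hs)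
    · have hs' : s ∈ l := by simpa using hs
      have ht' : t ∈ l := by simpa using ht
      refine LimitEq.unique hf (hpl s hs') ?_ (hps s hs') ?_
      · rw [e]; exact hpl t ht'
      · rw [e]; exact hps t ht'
  rw [List.toFinset_card_of_nodup hl] at hsub
  have := τ.toFinset_card_le
  omega

theorem TwoBounded.eventually_ne (hf : TwoBounded f) (x c : ℕ) : ∀ᶠ s in atTop, f x s ≠ c := by
  have hfin : {p : ℕ × ℕ | p.1 < p.2 ∧ f p.1 p.2 = c}.Finite :=
    Set.finite_of_encard_le_coe (hf c)
  obtain ⟨N, hN⟩ := (hfin.image Prod.snd).bddAbove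
  filter_upwards [eventually_gt_atTop N, eventually_gt_atTop x] with s hs hx h
  exact absurd (hN ⟨(x, s), ⟨hx, h⟩, rfl⟩) (by simpa using hs)

/-- Three things hold for large `s`: it exceeds `σ`; the new pairs `(x, s)` get distinct colors, by
limit-freeness and weak stability; and these colors differ from the finitely many old ones, by
2-boundedness. -/
theorem RainbowString.eventually (hf : TwoBounded f) (hf' : WeaklyRainbowStable f)
    (hσ : RainbowString f σ) (hσ' : LimitFree f σ) :
    ∀ᶠ s in atTop, RainbowString f (s :: σ) := by
  have hfin : {x | x ∈ σ}.Finite := List.finite_toSet σ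
  have h1 : ∀ᶠ s in atTop, ∀ x ∈ {x | x ∈ σ}, x < s :=
    (eventually_all_finite hfin).2 fun x _ => eventually_gt_atTop x
  have h2 : ∀ᶠ s in atTop, ∀ x ∈ {x | x ∈ σ}, ∀ y ∈ {x | x ∈ σ}, x = y ∨ f x s ≠ f y s := by
    refine (eventually_all_finite hfin).2 fun x hx => (eventually_all_finite hfin).2 fun y hy => ?_
    rcases hσ' x hx y hy with e | e
    · exact Eventually.of_forall fun s => Or.inl e
    · exact ((hf' x y).resolve_left e).mono fun s => Or.inr
  have h3 : ∀ᶠ s in atTop, ∀ x ∈ {x | x ∈ σ}, ∀ y ∈ {x | x ∈ σ}, ∀ z ∈ {x | x ∈ σ},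
      f z s ≠ f x y :=
    (eventually_all_finite hfin).2 fun x _ => (eventually_all_finite hfin).2 fun y _ =>
      (eventually_all_finite hfin).2 fun z _ => hf.eventually_ne z _
  filter_upwards [h1, h2, h3] with s h1 h2 h3
  refine ⟨List.pairwise_cons.2 ⟨fun x hx => h1 x hx, hσ.1⟩, isRainbow_iff.2 ?_⟩
  have hr := isRainbow_iff.1 hσ.2
  intro x₁ hx₁ y₁ hy₁ x₂ hx₂ y₂ hy₂ l₁ l₂ e
  have aux : ∀ x y, x ∈ s :: σ → y ∈ s :: σ → x < y → x ∈ σ := by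
    intro x y hx hy hxy
    refine (List.mem_cons.1 hx).resolve_left ?_
    rintro rfl
    rcases List.mem_cons.1 hy with rfl | hy
    · omega
    · exact absurd (h1 y hy) (by omega)
  have hx₁' := aux x₁ y₁ hx₁ hy₁ l₁
  have hx₂' := aux x₂ y₂ hx₂ hy₂ l₂
  rcases List.mem_cons.1 hy₁ with rfl | hy₁' <;> rcases List.mem_cons.1 hy₂ with rfl | hy₂'
  · exact ⟨(h2 x₁ hx₁' x₂ hx₂').resolve_right (not_not.2 e), rfl⟩
  · exact absurd e (h3 x₂ hx₂' y₂ hy₂' x₁ hx₁')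
  · exact absurd e.symm (h3 x₁ hx₁' y₁ hy₁' x₂ hx₂')
  · exact hr x₁ hx₁' y₁ hy₁' x₂ hx₂' y₂ hy₂' l₁ l₂ e

theorem initSeg_join_congr {A B : Set ℕ} {m k : ℕ} (hk : k ≤ 2 * m)
    (h : ∀ a < m, (a ∈ A ↔ a ∈ B)) : initSeg (join A X) k = initSeg (join B X) k := by
  refine initSeg_congr fun i hi => ?_
  rw [mem_join, mem_join]
  refine exists_congr fun a => or_congr (and_congr_right fun e => h a (by omega)) Iff.rfl

theorem RainbowString.mem_of_suffix (hτ : τ.Pairwise (· > ·)) (h : σ <:+ τ) {a m : ℕ} (hm : m ∈ σ)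
    (ha : a < m) (haτ : a ∈ τ) : a ∈ σ := by
  obtain ⟨ρ, rfl⟩ := h
  refine (List.mem_append.1 haτ).resolve_left fun h' => ?_
  exact absurd ((List.pairwise_append.1 hτ).2.2 a h' m hm) (by omega)

/-- The bound `k ≤ 2 * m` restricts the computation to elements of the left half below `m`. As
strings decrease and grow at the head, an extension adds nothing below an element `m` of `σ`. -/
theorem Forces.mono {e : ℕ} (h : Forces f X e σ) (hσ : σ <:+ τ) (hτ : RainbowString f τ) :
    Forces f X e τ := by
  obtain ⟨-, m, hm, k, hk, hd⟩ := h
  refine ⟨hτ, m, hσ.subset hm, k, hk, ?_⟩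
  rwa [initSeg_join_congr hk (B := {x | x ∈ σ})]
  exact fun a ha => ⟨RainbowString.mem_of_suffix hτ.1 hσ hm ha, fun h => hσ.subset h⟩

theorem exists_extension (hf : TwoBounded f) (hf' : WeaklyRainbowStable f)
    (hσ : RainbowString f σ) (hσ' : LimitFree f σ) {c : ℕ} {B : List ℕ → Prop}
    (hB : ¬ Big c B σ) :
    ∃ s, RainbowString f (s :: σ) ∧ LimitFree f (s :: σ) ∧ ¬ Big c B (s :: σ) := by
  obtain ⟨N, hN⟩ := eventually_atTop.1 (hσ.eventually hf hf' hσ')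
  obtain ⟨s, hs, h1, h2⟩ := Big.exists_child (P := LimitFree f)
    (fun l hl hlen => hσ'.exists_child hf hl hlen) hB
    -- Take enough consecutive numbers beyond `N`, all of which keep the string a rainbow.
    (l := (List.range ((c + 1) * (σ.length + 1))).map (N + ·))
    (List.nodup_range.map fun a b h => by simpa using h) (by simp)
  obtain ⟨a, -, rfl⟩ := List.mem_map.1 hs
  exact ⟨_, hN _ (by simp), h1, h2⟩

end Combinatorics

/-! ### Complexity of the notions used in the construction. -/

section Complexity

variable {f : ℕ → ℕ → ℕ} {X : Set ℕ}

theorem ceIn_rainbowString (hf : CEIn X fun p : (ℕ × ℕ) × ℕ => f p.1.1 p.1.2 = p.2) :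
    CEIn X (RainbowString f) := by
  refine CEIn.and (P := List.Pairwise (· > ·)) ?_ ?_
  · refine CEIn.of_eq (P := fun τ : List ℕ => ∀ j < τ.length, ∀ i < j, ∃ u v, τ[i]? = some u ∧
      τ[j]? = some v ∧ u > v) ?_ fun τ => ?_
    · exact CEIn.forall_lt (CEIn.forall_lt (CEIn.ex (CEIn.ex (CEIn.prim (by fun_prop))))
        (by fun_prop)) (by fun_prop)
    · rw [List.pairwise_iff_getElem]
      constructor
      · intro h i j hi hj hij
        obtain ⟨u, v, hu, hv, huv⟩ := h j hj i hij
        rw [List.getElem?_eq_getElem hi] at hu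
        rw [List.getElem?_eq_getElem hj] at hv
        cases hu; cases hv; exact huv
      · intro h j hj i hij
        exact ⟨_, _, List.getElem?_eq_getElem (hij.trans hj), List.getElem?_eq_getElem hj,
          h i j _ hj hij⟩
  · refine CEIn.of_eq (P := fun τ : List ℕ => ∀ x₁ ∈ τ, ∀ y₁ ∈ τ, ∀ x₂ ∈ τ, ∀ y₂ ∈ τ,
      (y₁ ≤ x₁ ∨ y₂ ≤ x₂ ∨ (x₁ = x₂ ∧ y₁ = y₂)) ∨ ∃ c d, f x₁ y₁ = c ∧ f x₂ y₂ = d ∧ c ≠ d) ?_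
      fun τ => ?_
    · refine CEIn.forall_mem (CEIn.forall_mem (CEIn.forall_mem (CEIn.forall_mem (CEIn.or
        (CEIn.prim (by fun_prop)) (CEIn.ex (CEIn.ex (CEIn.and ?_ (CEIn.and ?_
          (CEIn.prim (by fun_prop))))))) (by fun_prop)) (by fun_prop)) (by fun_prop)) (by fun_prop)
      · exact hf.comp (f := fun p : (((((List ℕ × ℕ) × ℕ) × ℕ) × ℕ) × ℕ) × ℕ =>
          ((p.1.1.1.1.1.2, p.1.1.1.1.2), p.1.2)) (by fun_prop)
      · exact hf.comp (f := fun p : (((((List ℕ × ℕ) × ℕ) × ℕ) × ℕ) × ℕ) × ℕ =>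
          ((p.1.1.1.2, p.1.1.2), p.2)) (by fun_prop)
    · rw [isRainbow_iff]
      refine forall_congr' fun x₁ => forall_congr' fun _ => forall_congr' fun y₁ =>
        forall_congr' fun _ => forall_congr' fun x₂ => forall_congr' fun _ =>
        forall_congr' fun y₂ => forall_congr' fun _ => ?_
      constructor
      · rintro ((h | h | h) | ⟨c, d, rfl, rfl, h⟩) h1 h2 e
        · omega
        · omega
        · exact h
        · exact absurd e h
      · intro h
        by_cases h1 : x₁ < y₁
        · by_cases h2 : x₂ < y₂
          · by_cases e : f x₁ y₁ = f x₂ y₂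
            · exact Or.inl (Or.inr (Or.inr (h h1 h2 e)))
            · exact Or.inr ⟨_, _, rfl, rfl, e⟩
          · exact Or.inl (Or.inr (Or.inl (by omega)))
        · exact Or.inl (Or.inl (by omega))

/-- Weak stability turns "not eventually equal" into "eventually different", which is `Σ⁰₂` in `X`
and hence c.e. in `X'`. -/
theorem ceIn_limitFree (hf : CEIn X fun p : (ℕ × ℕ) × ℕ => f p.1.1 p.1.2 = p.2)
    (hf' : WeaklyRainbowStable f) : CEIn (jump X) (LimitFree f) := by
  have h1 : CEIn X fun p : (ℕ × ℕ) × ℕ => ∃ s c, p.2 ≤ s ∧ f p.1.1 s = c ∧ f p.1.2 s = c := by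
    refine CEIn.ex (CEIn.ex ((CEIn.prim (by fun_prop)).and (CEIn.and ?_ ?_)))
    · exact hf.comp (f := fun p : (((ℕ × ℕ) × ℕ) × ℕ) × ℕ => ((p.1.1.1.1, p.1.2), p.2))
        (by fun_prop)
    · exact hf.comp (f := fun p : (((ℕ × ℕ) × ℕ) × ℕ) × ℕ => ((p.1.1.1.2, p.1.2), p.2))
        (by fun_prop)
  have h2 : CEIn (jump X) fun p : ℕ × ℕ => ¬ LimitEq f p.1 p.2 := by
    refine (CEIn.ex (P := fun (p : ℕ × ℕ) (t : ℕ) =>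
      ¬ ∃ s c, t ≤ s ∧ f p.1 s = c ∧ f p.2 s = c) h1.not_to_jump).of_eq fun p => ?_
    constructor
    · rintro ⟨t, ht⟩ h
      obtain ⟨s, hs, hts⟩ := (Eventually.and h (eventually_ge_atTop t)).exists
      exact ht ⟨s, _, hts, hs, rfl⟩
    · intro h
      obtain ⟨t, ht⟩ := eventually_atTop.1 ((hf' p.1 p.2).resolve_left h)
      refine ⟨t, ?_⟩
      rintro ⟨s, c, hs, e, e'⟩
      exact ht s hs (e.trans e'.symm)
  refine CEIn.forall_mem (CEIn.forall_mem ((CEIn.prim (by fun_prop)).or ?_) (by fun_prop))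
    (by fun_prop)
  exact h2.comp (f := fun p : (List ℕ × ℕ) × ℕ => (p.1.2, p.2)) (by fun_prop)

theorem ceIn_join_initSeg (X : Set ℕ) : CEIn X fun p : (List ℕ × ℕ) × List Bool =>
    p.2 = initSeg (join {x | x ∈ p.1.1} X) p.1.2 := by
  refine CEIn.of_eq (P := fun p : (List ℕ × ℕ) × List Bool => p.2.length = p.1.2 ∧ ∀ i < p.1.2,
      (p.2[i]? = some true ∧ ∃ a, (i = 2 * a ∧ a ∈ p.1.1) ∨ (i = 2 * a + 1 ∧ a ∈ X)) ∨
      (p.2[i]? = some false ∧ ∃ a, (i = 2 * a ∧ ¬ a ∈ p.1.1) ∨ (i = 2 * a + 1 ∧ a ∉ X))) ?_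
    fun p => ?_
  · refine (CEIn.prim (by fun_prop)).and (CEIn.forall_lt (CEIn.or
      ((CEIn.prim (by fun_prop)).and (CEIn.ex (CEIn.or (CEIn.prim (by fun_prop))
        ((CEIn.prim (by fun_prop)).and (CEIn.mem (by fun_prop))))))
      ((CEIn.prim (by fun_prop)).and (CEIn.ex (CEIn.or (CEIn.prim (by fun_prop))
        ((CEIn.prim (by fun_prop)).and (CEIn.notMem (by fun_prop))))))) (by fun_prop))
  · rw [eq_initSeg_iff]
    refine and_congr Iff.rfl (forall_congr' fun i => forall_congr' fun _ => ?_)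
    rw [notMem_join, mem_join]
    rfl

theorem ceIn_forces (hf : CEIn X fun p : (ℕ × ℕ) × ℕ => f p.1.1 p.1.2 = p.2) :
    CEIn X fun p : ℕ × List ℕ => Forces f X p.1 p.2 := by
  refine CEIn.and ((ceIn_rainbowString hf).comp Primrec.snd) ?_
  refine CEIn.of_eq (P := fun p : ℕ × List ℕ => ∃ m k : ℕ, ∃ ρ : List Bool, ∃ w : ℕ,
    (m ∈ p.2 ∧ k ≤ 2 * m) ∧ ρ = initSeg (join {x | x ∈ p.2} X) k ∧
    ((Denumerable.ofNat Nat.Partrec.Code p.1).evaln w (Encodable.encode (ρ, p.1))).isSome = true) ?_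
    fun p => ?_
  · refine CEIn.ex (CEIn.ex (CEIn.ex (CEIn.ex ((CEIn.prim (by fun_prop)).and
      (CEIn.and ?_ (CEIn.prim (by fun_prop)))))))
    exact (ceIn_join_initSeg X).comp (f := fun p : ((((ℕ × List ℕ) × ℕ) × ℕ) × List Bool) × ℕ
      => ((p.1.1.1.1.2, p.1.1.2), p.1.2)) (by fun_prop)
  · simp only [Part.dom_iff_mem, Nat.Partrec.Code.evaln_complete, Option.isSome_iff_exists,
      Option.mem_def]
    constructor
    · rintro ⟨m, k, ρ, w, ⟨hm, hk⟩, rfl, a, h⟩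
      exact ⟨m, hm, k, hk, a, w, h⟩
    · rintro ⟨m, hm, k, hk, a, w, h⟩
      exact ⟨m, k, _, w, ⟨hm, hk⟩, rfl, a, h⟩

end Complexity

/-- Some element of `E` is forced into the jump. -/
def ForcesSome (f : ℕ → ℕ → ℕ) (X : Set ℕ) (E τ : List ℕ) : Prop := ∃ i ∈ E, Forces f X i τ

/-- States `(e, c, σ, E)` of the construction: at stage `e`, the finite rainbow `σ` has been built
and the numbers in `E` are kept out of the jump. -/
def GoodState (f : ℕ → ℕ → ℕ) (X : Set ℕ) (p : ℕ × ℕ × List ℕ × List ℕ) : Prop :=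
  (RainbowString f p.2.2.1 ∧ LimitFree f p.2.2.1) ∧ ¬ Big p.2.1 (ForcesSome f X p.2.2.2) p.2.2.1

/-- `q` is a possible state after `p`. -/
def NextState (f : ℕ → ℕ → ℕ) (X : Set ℕ) (p q : ℕ × ℕ × List ℕ × List ℕ) : Prop :=
  (q.1 = p.1 + 1 ∧ ∃ s ρ, q.2.2.1 = s :: ρ ++ p.2.2.1) ∧ GoodState f X q ∧
    ((q.2.2.2 = p.2.2.2 ∧ Forces f X p.1 q.2.2.1) ∨ q.2.2.2 = p.1 :: p.2.2.2)

/-! ### The `X'`-computable construction of a rainbow low over `X`. -/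

section Construction

variable {f : ℕ → ℕ → ℕ} {X : Set ℕ}

theorem ceIn_nextState (hf : CEIn X fun p : (ℕ × ℕ) × ℕ => f p.1.1 p.1.2 = p.2)
    (hf' : WeaklyRainbowStable f) :
    CEIn (jump X) fun p : (ℕ × ℕ × List ℕ × List ℕ) × (ℕ × ℕ × List ℕ × List ℕ) =>
      NextState f X p.1 p.2 := by
  have hB : CEIn X fun p : List ℕ × List ℕ => ForcesSome f X p.1 p.2 := by
    refine CEIn.ex ((CEIn.prim (by fun_prop)).and ?_)
    exact (ceIn_forces hf).comp (f := fun p : (List ℕ × List ℕ) × ℕ => (p.2, p.1.2))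
      (by fun_prop)
  refine CEIn.and (CEIn.and (CEIn.prim (by fun_prop)) (CEIn.ex (CEIn.ex (CEIn.prim (by fun_prop)))))
    (CEIn.and (CEIn.and (CEIn.and ?_ ?_) ?_)
      (CEIn.or (CEIn.and (CEIn.prim (by fun_prop)) ?_) (CEIn.prim (by fun_prop))))
  · exact (ceIn_rainbowString hf).to_jump.comp (f := fun p : (ℕ × ℕ × List ℕ × List ℕ) ×
      (ℕ × ℕ × List ℕ × List ℕ) => p.2.2.2.1) (by fun_prop)
  · exact (ceIn_limitFree hf hf').comp (f := fun p : (ℕ × ℕ × List ℕ × List ℕ) ×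
      (ℕ × ℕ × List ℕ × List ℕ) => p.2.2.2.1) (by fun_prop)
  · exact (CEIn.big hB).not_to_jump.comp (f := fun p : (ℕ × ℕ × List ℕ × List ℕ) ×
      (ℕ × ℕ × List ℕ × List ℕ) => ((p.2.2.2.2, p.2.2.1), p.2.2.2.1)) (by fun_prop)
  · exact (ceIn_forces hf).to_jump.comp (f := fun p : (ℕ × ℕ × List ℕ × List ℕ) ×
      (ℕ × ℕ × List ℕ × List ℕ) => (p.1.1, p.2.2.2.1)) (by fun_prop)

/-- Either forcing `e` is `(c + 1)`-big above `σ`, and a leaf is reached that forces it without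
spoiling smallness for `E`; or it is not, and `e` joins `E` at the price of a larger constant. -/
theorem exists_nextState (hf : TwoBounded f) (hf' : WeaklyRainbowStable f)
    {p : ℕ × ℕ × List ℕ × List ℕ} (hp : GoodState f X p) : ∃ q, NextState f X p q := by
  obtain ⟨e, c, σ, E⟩ := p
  obtain ⟨⟨h1, h2⟩, h3⟩ := hp
  by_cases h : Big (c + 1) (Forces f X e) σ
  · obtain ⟨τ, hστ, hτ, hτ', hτB⟩ := h.exists_leaf (P := LimitFree f)
      (fun τ hτ l hl hlen => hτ.exists_child hf hl hlen) h3 h2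
    -- The leaf `τ` may be `σ` itself, so one more element is added to make the rainbow grow at
    -- every stage.
    obtain ⟨s, hs1, hs2, hs3⟩ := exists_extension hf hf' hτ.1 hτ' hτB
    obtain ⟨ρ, rfl⟩ := hστ
    exact ⟨(e + 1, c, s :: (ρ ++ σ), E), ⟨rfl, s, ρ, rfl⟩, ⟨⟨hs1, hs2⟩, hs3⟩,
      Or.inl ⟨rfl, hτ.mono (List.suffix_cons _ _) hs1⟩⟩
  · have h4 : ¬ Big (c + 1 + c) (ForcesSome f X (e :: E)) σ := by
      intro hb
      have : ForcesSome f X (e :: E) = fun τ => Forces f X e τ ∨ ForcesSome f X E τ := by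
        funext τ; simp [ForcesSome]
      rw [this] at hb
      exact hb.or.elim h h3
    obtain ⟨s, hs1, hs2, hs3⟩ := exists_extension hf hf' h1 h2 h4
    exact ⟨(e + 1, c + 1 + c, s :: σ, e :: E), ⟨rfl, s, [], rfl⟩, ⟨⟨hs1, hs2⟩, hs3⟩, Or.inr rfl⟩

theorem exists_rainbow_lowOver (hf : CEIn X fun p : (ℕ × ℕ) × ℕ => f p.1.1 p.1.2 = p.2)
    (hb : TwoBounded f) (hf' : WeaklyRainbowStable f) :
    ∃ R : Set ℕ, R.Infinite ∧ IsRainbow f R ∧ LowOver R X := by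
  have h0 : GoodState f X (0, 1, [], []) := by
    refine ⟨⟨⟨List.Pairwise.nil, isRainbow_iff.2 ?_⟩, ?_⟩, Big.not_of_no_leaf le_rfl ?_⟩
    · intro x hx; exact absurd hx (by simp)
    · intro x hx; exact absurd hx (by simp)
    · rintro τ ⟨i, hi, -⟩; exact absurd hi (by simp)
  obtain ⟨s, hs0, hgood, hnext, hce⟩ := CEIn.exists_sequence (ceIn_nextState hf hf') h0
    (fun _ _ _ h => h.2.1) (fun _ => exists_nextState hb hf')
  have hstage : ∀ n, (s n).1 = n := by
    intro n
    induction n with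
    | zero => rw [hs0]
    | succ n ih => rw [(hnext n).1.1, ih]
  set σ : ℕ → List ℕ := fun n => (s n).2.2.1 with hσ
  have hstep : ∀ n, σ n <:+ σ (n + 1) ∧ (σ n).length < (σ (n + 1)).length := by
    intro n
    obtain ⟨a, ρ, h⟩ := (hnext n).1.2
    have h' : σ (n + 1) = (a :: ρ) ++ σ n := h
    rw [h']
    exact ⟨List.suffix_append _ _, by simp⟩
  have hmono : ∀ m n, m ≤ n → σ m <:+ σ n := fun m n h =>
    Nat.le_induction (List.suffix_rfl) (fun k _ ih => ih.trans (hstep k).1) n h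
  have hlen : ∀ n, n ≤ (σ n).length := by
    intro n
    induction n with
    | zero => simp
    | succ n ih => have := (hstep n).2; omega
  have hrain : ∀ n, RainbowString f (σ n) := fun n => (hgood n).1.1
  let R : Set ℕ := {x | ∃ n, x ∈ σ n}
  have hRσ : ∀ n m, m ∈ σ n → ∀ a < m, a ∈ R ↔ a ∈ {x | x ∈ σ n} := by
    intro n m hm a ha
    constructor
    · rintro ⟨k, hk⟩
      have hk' : a ∈ σ (max n k) := (hmono k _ (le_max_right _ _)).subset hk
      exact RainbowString.mem_of_suffix (hrain _).1 (hmono n _ (le_max_left n k)) hm ha hk'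
    · exact fun h => ⟨n, h⟩
  have hinf : R.Infinite := by
    intro hfin
    have h1 : (σ (hfin.toFinset.card + 1)).toFinset ⊆ hfin.toFinset := by
      intro x hx
      simpa using ⟨_, List.mem_toFinset.1 hx⟩
    have h2 := Finset.card_le_card h1
    rw [List.toFinset_card_of_nodup ((hrain _).1.imp fun h => ne_of_gt h)] at h2
    have := hlen (hfin.toFinset.card + 1)
    omega
  refine ⟨R, hinf, isRainbow_iff.2 ?_, ?_⟩
  · rintro x₁ ⟨a, ha⟩ y₁ ⟨b, hb⟩ x₂ ⟨c, hc⟩ y₂ ⟨d, hd⟩ h1 h2 e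
    refine isRainbow_iff.1 (hrain (a + b + c + d)).2 x₁ ?_ y₁ ?_ x₂ ?_ y₂ ?_ h1 h2 e
    · exact (hmono _ _ (by omega)).subset ha
    · exact (hmono _ _ (by omega)).subset hb
    · exact (hmono _ _ (by omega)).subset hc
    · exact (hmono _ _ (by omega)).subset hd
  · have hjump : ∀ e, e ∈ jump (join R X) ↔ ∃ n, Forces f X e (σ n) := by
      intro e
      constructor
      · rintro ⟨k, hk⟩
        obtain ⟨m, ⟨n, hn⟩, hkm⟩ := hinf.exists_gt k
        refine ⟨n, hrain n, m, hn, k, by omega, ?_⟩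
        rwa [← initSeg_join_congr (m := m) (by omega) (hRσ n m hn)]
      · rintro ⟨n, -, m, hm, k, hk, h⟩
        refine ⟨k, ?_⟩
        rwa [initSeg_join_congr hk (hRσ n m hm)]
    have hE : ∀ m n, m ≤ n → (s m).2.2.2 ⊆ (s n).2.2.2 := fun m n h =>
      Nat.le_induction (List.Subset.refl _) (fun k _ ih => List.Subset.trans ih (by
        rcases (hnext k).2.2 with h | h
        · rw [h.1]; exact List.Subset.refl _
        · rw [h]; exact List.subset_cons_self _ _)) n h
    have hnot : ∀ n e, e ∈ (s n).2.2.2 → ¬ Forces f X e (σ n) := fun n e he h =>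
      (hgood n).2 (Big.leaf ⟨e, he, h⟩)
    -- The fate of `e` is settled in passing from stage `e` to stage `e + 1`. Smallness at all later
    -- stages prevents a member of `E` from ever being forced.
    have hdec : ∀ e, e ∈ jump (join R X) ↔ ¬ e ∈ (s (e + 1)).2.2.2 := by
      intro e
      rw [hjump]
      constructor
      · rintro ⟨n, hn⟩ he
        refine hnot (max n (e + 1)) e (hE _ _ (le_max_right _ _) he) ?_
        exact hn.mono (hmono _ _ (le_max_left _ _)) (hrain _)
      · intro he
        rcases (hnext e).2.2 with h | h
        · rw [hstage] at h
          exact ⟨_, h.2⟩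
        · rw [h, hstage] at he
          simp at he
    refine turingLE_iff.2 ⟨?_, ?_⟩
    · refine CEIn.of_eq (P := fun e => ∃ q, s (e + 1) = q ∧ ¬ e ∈ q.2.2.2) ?_ fun e => ?_
      · refine CEIn.ex (CEIn.and ?_ (CEIn.prim (by fun_prop)))
        exact hce.comp (f := fun p : ℕ × (ℕ × ℕ × List ℕ × List ℕ) => (p.1 + 1, p.2))
          (by fun_prop)
      · rw [hdec]; simp
    · refine CEIn.of_eq (P := fun e => ∃ q, s (e + 1) = q ∧ e ∈ q.2.2.2) ?_ fun e => ?_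
      · refine CEIn.ex (CEIn.and ?_ (CEIn.prim (by fun_prop)))
        exact hce.comp (f := fun p : ℕ × (ℕ × ℕ × List ℕ × List ℕ) => (p.1 + 1, p.2))
          (by fun_prop)
      · rw [hdec]; simp

end Construction

theorem exists_rainbow_lowOver_of_computableIn {X : Set ℕ} {f : ℕ → ℕ → ℕ}
    (hf : ColoringComputableIn X f) (hb : TwoBounded f) (hs : WeaklyRainbowStable f) :
    ∃ R : Set ℕ, R.Infinite ∧ IsRainbow f R ∧ LowOver R X := by
  obtain ⟨F, hF, hFf⟩ := hf
  have h1 : TwoBounded fun x y => F (x, y) := by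
    refine twoBounded_iff.2 fun p q r hp hq hr h1 h2 => ?_
    simp only [hFf _ _ hp, hFf _ _ hq, hFf _ _ hr] at h1 h2
    exact twoBounded_iff.1 hb p q r hp hq hr h1 h2
  have h2 : WeaklyRainbowStable fun x y => F (x, y) := by
    intro x y
    refine (hs x y).imp (fun h => ?_) fun h => ?_ <;>
    · filter_upwards [h, eventually_gt_atTop x, eventually_gt_atTop y] with s h hx hy
      rwa [hFf _ _ hx, hFf _ _ hy]
  obtain ⟨R, hR, hR', hlow⟩ := exists_rainbow_lowOver (ColoringComputableIn.ceIn hF) h1 h2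
  refine ⟨R, hR, isRainbow_iff.2 ?_, hlow⟩
  intro x₁ hx₁ y₁ hy₁ x₂ hx₂ y₂ hy₂ h1 h2 e
  rw [← hFf _ _ h1, ← hFf _ _ h2] at e
  exact isRainbow_iff.1 hR' x₁ hx₁ y₁ hy₁ x₂ hx₂ y₂ hy₂ h1 h2 e

/-! ### Bounded formulas are decidable in their set parameters. -/

section Arithmetic

variable {S : Set (Set ℕ)} {Y : Set ℕ} {α : Type} [Primcodable α]

theorem primrec_val {k : ℕ} {v : α → Fin k → ℕ} (hv : ∀ i, Primrec fun a => v a i)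
    (t : NumTerm k) :
    @Primrec α ℕ _ _ fun a => (omegaStructure S).val (v a) t := by
  induction t with
  | var i => exact hv i
  | zero => exact Primrec.const 0
  | one => exact Primrec.const 1
  | add s t hs ht => exact Primrec.nat_add.comp hs ht
  | mul s t hs ht => exact Primrec.nat_mul.comp hs ht

/-- A formula and its negation are treated together for the sake of negation and bounded
quantifiers. The type `α` varies in the induction because a quantifier adds a variable to the
context. -/
theorem ceIn_holds {m : ℕ} {A : Fin m → Set ℕ} (hA : ∀ i, TuringLE (A i) Y) {k : ℕ}
    (φ : BddFormula m k) : ∀ {α : Type} [Primcodable α] (v : α → Fin k → ℕ),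
      (∀ i, Primrec fun a => v a i) →
      CEIn Y (fun a => (omegaStructure S).Holds A (v a) φ) ∧
      CEIn Y (fun a => ¬ (omegaStructure S).Holds A (v a) φ) := by
  induction φ with
  | eq s t =>
    intro α _ v hv
    have h := primrecPred_eq (primrec_val (S := S) hv s) (primrec_val (S := S) hv t)
    exact ⟨CEIn.prim h, CEIn.prim h.not⟩
  | lt s t =>
    intro α _ v hv
    have h := primrecPred_lt (primrec_val (S := S) hv s) (primrec_val (S := S) hv t)
    exact ⟨CEIn.prim h, CEIn.prim h.not⟩
  | mem t X =>
    intro α _ v hv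
    have h := turingLE_iff.1 (hA X)
    exact ⟨h.1.comp (primrec_val (S := S) hv t), h.2.comp (primrec_val (S := S) hv t)⟩
  | neg φ ih =>
    intro α _ v hv
    exact ⟨(ih v hv).2, (ih v hv).1.of_eq fun a => not_not.symm⟩
  | and φ ψ ihφ ihψ =>
    intro α _ v hv
    exact ⟨(ihφ v hv).1.and (ihψ v hv).1,
      ((ihφ v hv).2.or (ihψ v hv).2).of_eq fun a => not_and_or.symm⟩
  | @ball k t φ ih =>
    intro α _ v hv
    have ht := primrec_val (S := S) hv t
    obtain ⟨h1, h2⟩ := ih (α := α × ℕ) (fun p => Fin.cons p.2 (v p.1)) (by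
      intro i
      refine Fin.cases ?_ (fun i => ?_) i
      · exact Primrec.snd
      · exact (hv i).comp Primrec.fst)
    refine ⟨CEIn.forall_lt h1 ht, ?_⟩
    refine CEIn.of_eq (CEIn.ex (P := fun (a : α) (x : ℕ) =>
      x < (omegaStructure S).val (v a) t ∧ ¬ (omegaStructure S).Holds A
        (Fin.cons x (v a) : Fin (k + 1) → ℕ) φ)
      (CEIn.and (CEIn.prim (primrecPred_lt Primrec.snd (ht.comp Primrec.fst))) h2)) fun a => ?_
    simp only [L2Structure.Holds]
    push Not
    rfl

end Arithmetic

theorem two_mul_mem_join {A B : Set ℕ} {n : ℕ} : 2 * n ∈ join A B ↔ n ∈ A := by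
  rw [mem_join]
  refine ⟨?_, fun h => ⟨n, Or.inl ⟨rfl, h⟩⟩⟩
  rintro ⟨a, ⟨e, h⟩ | ⟨e, h⟩⟩
  · obtain rfl : n = a := by omega
    exact h
  · omega

theorem two_mul_add_one_mem_join {A B : Set ℕ} {n : ℕ} : 2 * n + 1 ∈ join A B ↔ n ∈ B := by
  rw [mem_join]
  refine ⟨?_, fun h => ⟨n, Or.inr ⟨rfl, h⟩⟩⟩
  rintro ⟨a, ⟨e, h⟩ | ⟨e, h⟩⟩
  · omega
  · obtain rfl : n = a := by omega
    exact h

theorem TuringLE.join_left (A B : Set ℕ) : TuringLE A (join A B) :=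
  turingLE_iff.2 ⟨(CEIn.mem (f := fun n => 2 * n) (by fun_prop)).of_eq fun _ => two_mul_mem_join,
    (CEIn.notMem (f := fun n => 2 * n) (by fun_prop)).of_eq fun _ => two_mul_mem_join.not⟩

theorem TuringLE.join_right (A B : Set ℕ) : TuringLE B (join A B) :=
  turingLE_iff.2 ⟨(CEIn.mem (f := fun n => 2 * n + 1) (by fun_prop)).of_eq
      fun _ => two_mul_add_one_mem_join,
    (CEIn.notMem (f := fun n => 2 * n + 1) (by fun_prop)).of_eq
      fun _ => two_mul_add_one_mem_join.not⟩

/-- Covers the default value of `solution`, so that every stage of the sequence is low whether or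
not it meets a genuine instance. -/
theorem lowOver_empty (X : Set ℕ) : LowOver ∅ X := by
  refine TuringLE.jump (turingLE_iff.2 ⟨?_, ?_⟩)
  · refine (CEIn.ex (P := fun i a => i = 2 * a + 1 ∧ a ∈ X) ((CEIn.prim (by fun_prop)).and
      (CEIn.mem (by fun_prop)))).of_eq fun i => ?_
    rw [mem_join]
    simp
  · refine (CEIn.ex (P := fun i a => i = 2 * a ∨ (i = 2 * a + 1 ∧ a ∉ X)) ((CEIn.prim
      (by fun_prop)).or ((CEIn.prim (by fun_prop)).and (CEIn.notMem (by fun_prop))))).of_eq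
      fun i => ?_
    rw [notMem_join]
    simp

/-! ### Turing ideals generated by a sequence -/

/-- The sets computable in some member of the sequence `X`. -/
def lowerClosure (X : ℕ → Set ℕ) : Set (Set ℕ) := {A | ∃ n, TuringLE A (X n)}

section Ideal

variable {X : ℕ → Set ℕ}

theorem turingLE_of_le (hX : ∀ n, TuringLE (X n) (X (n + 1))) {m n : ℕ} (h : m ≤ n) :
    TuringLE (X m) (X n) :=
  Nat.le_induction (TuringLE.refl _) (fun k _ ih => ih.trans (hX k)) n h

theorem exists_common_bound (hX : ∀ n, TuringLE (X n) (X (n + 1))) {m : ℕ} {A : Fin m → Set ℕ}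
    (hA : ∀ i, A i ∈ lowerClosure X) : ∃ N, ∀ n, N ≤ n → ∀ i, TuringLE (A i) (X n) := by
  choose g hg using hA
  exact ⟨Finset.univ.sup g, fun n hn i => (hg i).trans
    (turingLE_of_le hX ((Finset.le_sup (Finset.mem_univ i)).trans hn))⟩

theorem exists_ceIn_of_isSigma01 (hX : ∀ n, TuringLE (X n) (X (n + 1))) {P : ℕ → Prop}
    (hP : (omegaStructure (lowerClosure X)).IsSigma01 P) : ∃ N, ∀ n, N ≤ n → CEIn (X n) P := by
  obtain ⟨m, k, θ, A, v, hA, h⟩ := hP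
  obtain ⟨N, hN⟩ := exists_common_bound hX hA
  refine ⟨N, fun n hn => ?_⟩
  have h1 := (ceIn_holds (S := lowerClosure X) (hN n hn) θ (α := ℕ × ℕ)
    (fun p => Fin.cons p.2 (Fin.cons p.1 v : Fin (k + 1) → ℕ)) fun i => ?_).1
  · exact CEIn.of_eq (CEIn.ex (β := ℕ) h1) fun x => (h x).symm
  refine Fin.cases ?_ (fun i => Fin.cases ?_ (fun i => ?_) i) i
  · exact Primrec.snd
  · exact Primrec.fst
  · exact @Primrec.const (ℕ × ℕ) ℕ _ _ (v i)

theorem exists_ceIn_not_of_isPi01 (hX : ∀ n, TuringLE (X n) (X (n + 1))) {P : ℕ → Prop}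
    (hP : (omegaStructure (lowerClosure X)).IsPi01 P) :
    ∃ N, ∀ n, N ≤ n → CEIn (X n) fun x => ¬ P x := by
  obtain ⟨m, k, θ, A, v, hA, h⟩ := hP
  refine exists_ceIn_of_isSigma01 hX (P := fun x => ¬ P x) ⟨m, k, .neg θ, A, v, hA, fun x => ?_⟩
  exact (h x).not.trans not_forall

/-- Induction is true in `ℕ`. For comprehension, the predicate and its complement are both c.e. in
one term of the sequence, so Post's theorem applies. -/
theorem modelsRCA₀_lowerClosure (hX : ∀ n, TuringLE (X n) (X (n + 1))) :
    (omegaStructure (lowerClosure X)).ModelsRCA₀ where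
  succ_ne_zero := Nat.succ_ne_zero
  succ_inj _ _ := Nat.succ.inj
  add_zero := Nat.add_zero
  add_succ _ _ := rfl
  mul_zero := Nat.mul_zero
  mul_succ _ _ := rfl
  not_lt_zero := Nat.not_lt_zero
  lt_succ _ _ := Nat.lt_succ_iff_lt_or_eq
  sigma01_induction _ _ h0 hs n := Nat.rec h0 hs n
  delta01_comprehension P hS hP := by
    obtain ⟨N, hN⟩ := exists_ceIn_of_isSigma01 hX hS
    obtain ⟨N', hN'⟩ := exists_ceIn_not_of_isPi01 hX hP
    exact ⟨max N N', turingLE_iff.2 ⟨hN _ (le_max_left _ _), hN' _ (le_max_right _ _)⟩⟩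

end Ideal

/-! ### Colorings coded by sets -/

/-- The pairing function of second order arithmetic. -/
def arithPair (i j : ℕ) : ℕ := (i + j) * (i + j) + i

theorem arithPair_inj {i j k l : ℕ} (h : arithPair i j = arithPair k l) : i = k ∧ j = l := by
  unfold arithPair at h
  have h1 : i + j = k + l := by
    rcases lt_trichotomy (i + j) (k + l) with h' | h' | h'
    · nlinarith
    · exact h'
    · nlinarith
  rw [h1] at h
  omega

@[fun_prop] theorem primrec_arithPair {α : Type*} [Primcodable α] {f g : α → ℕ} (hf : Primrec f)
    (hg : Primrec g) : Primrec fun a => arithPair (f a) (g a) := by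
  unfold arithPair; fun_prop

theorem hasColor_iff {S : Set (Set ℕ)} {F : Set ℕ} {x y c : ℕ} :
    (omegaStructure S).HasColor F x y c ↔ arithPair (arithPair x y) c ∈ F := Iff.rfl

/-- `R` is an infinite rainbow for the coloring coded by `F`. -/
def Solves (F R : Set ℕ) : Prop :=
  (omegaStructure ∅).IsInfinite R ∧ (omegaStructure ∅).IsRainbow F R

/-- `F` codes a weakly rainbow-stable 2-bounded coloring. -/
def IsInstance (F : Set ℕ) : Prop :=
  (omegaStructure ∅).IsColoring F ∧ (omegaStructure ∅).TwoBounded F ∧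
    (omegaStructure ∅).WeaklyRainbowStable F

theorem IsInstance.exists_solves {F X : Set ℕ} (hF : IsInstance F) (hFX : TuringLE F X) :
    ∃ R, LowOver R X ∧ Solves F R := by
  classical
  obtain ⟨hcol, hb, hs⟩ := hF
  have hcol' : ∀ x y : ℕ, x < y → ∃! c : ℕ, arithPair (arithPair x y) c ∈ F := hcol
  choose! g hg huniq using hcol'
  have hgF : ∀ {x y c : ℕ}, x < y → ((omegaStructure ∅).HasColor F x y c ↔ g x y = c) :=
    fun {x y c} hxy => ⟨fun h => (huniq x y hxy c h).symm, fun h => h ▸ hg x y hxy⟩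
  -- The value `0` off the domain makes the whole graph c.e. in `X`, whereas `g` is arbitrary there.
  let f : ℕ → ℕ → ℕ := fun x y => if x < y then g x y else 0
  have hf : ∀ {x y : ℕ}, x < y → f x y = g x y := fun h => if_pos h
  have hce : CEIn X fun p : (ℕ × ℕ) × ℕ => f p.1.1 p.1.2 = p.2 := by
    refine CEIn.of_eq (P := fun p : (ℕ × ℕ) × ℕ => (p.1.1 < p.1.2 ∧
      arithPair (arithPair p.1.1 p.1.2) p.2 ∈ F) ∨ (p.1.2 ≤ p.1.1 ∧ p.2 = 0)) ?_ fun p => ?_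
    · refine CEIn.or (CEIn.and (CEIn.prim (by fun_prop)) ?_) (CEIn.prim (by fun_prop))
      exact (turingLE_iff.1 hFX).1.comp (f := fun p : (ℕ × ℕ) × ℕ =>
        arithPair (arithPair p.1.1 p.1.2) p.2) (by fun_prop)
    · by_cases h : p.1.1 < p.1.2
      · have h' : ¬ p.1.2 ≤ p.1.1 := by omega
        rw [hf h, ← hgF h, hasColor_iff]
        simp [h, h']
      · have h' : p.1.2 ≤ p.1.1 := by omega
        simp [f, h, h', eq_comm]
  have hfb : TwoBounded f := by
    refine twoBounded_iff.2 fun p q r hp hq hr h1 h2 => ?_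
    rw [hf hp, hf hq] at h1
    rw [hf hp, hf hr] at h2
    rcases hb (g p.1 p.2) p.1 p.2 q.1 q.2 r.1 r.2 hp hq hr ((hgF hp).2 rfl) ((hgF hq).2 h1.symm)
      ((hgF hr).2 h2.symm) with h | h | h
    · exact Or.inl (Prod.ext h.1 h.2)
    · exact Or.inr (Or.inl (Prod.ext h.1 h.2))
    · exact Or.inr (Or.inr (Prod.ext h.1 h.2))
  have hfs : WeaklyRainbowStable f := by
    intro x y
    refine (hs x y).imp (fun h => ?_) fun h => ?_
    · obtain ⟨(t : ℕ), ht⟩ := h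
      filter_upwards [eventually_gt_atTop t, eventually_gt_atTop x, eventually_gt_atTop y]
        with s h1 h2 h3
      obtain ⟨c, hx, hy⟩ := ht s h1 h2 h3
      rw [hf h2, hf h3, (hgF h2).1 hx, (hgF h3).1 hy]
    · obtain ⟨(t : ℕ), ht⟩ := h
      filter_upwards [eventually_gt_atTop t, eventually_gt_atTop x, eventually_gt_atTop y]
        with s h1 h2 h3 e
      rw [hf h2, hf h3] at e
      exact ht s h1 h2 h3 ⟨g x s, (hgF h2).2 rfl, (hgF h3).2 e.symm⟩
  obtain ⟨R, hR, hR', hlow⟩ := exists_rainbow_lowOver hce hfb hfs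
  refine ⟨R, hlow, fun t => hR.exists_gt t, ?_⟩
  intro x₁ hx₁ y₁ hy₁ x₂ hx₂ y₂ hy₂ h1 h2 c hc1 hc2
  refine isRainbow_iff.1 hR' x₁ hx₁ y₁ hy₁ x₂ hx₂ y₂ hy₂ h1 h2 ?_
  rw [hf h1, hf h2, (hgF h1).1 hc1, (hgF h2).1 hc2]

/-- The set `B` such that `2 b + 1 ∈ A ↔ b ∈ B`. -/
def rightPart (A : Set ℕ) : Set ℕ := {b | 2 * b + 1 ∈ A}

theorem rightPart_join (A B : Set ℕ) : rightPart (join A B) = B :=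
  Set.ext fun _ => two_mul_add_one_mem_join

open Classical in
/-- A solution of the instance `F` that is low over `X`, if there is one. -/
noncomputable def solution (F X : Set ℕ) : Set ℕ :=
  if h : ∃ R, LowOver R X ∧ Solves F R then h.choose else ∅

theorem lowOver_solution (F X : Set ℕ) : LowOver (solution F X) X := by
  unfold solution
  split_ifs with h
  · exact h.choose_spec.1
  · exact lowOver_empty X

theorem IsInstance.solves_solution {F X : Set ℕ} (hF : IsInstance F) (hFX : TuringLE F X) :
    Solves F (solution F X) := by
  have h := hF.exists_solves hFX
  rw [solution, dif_pos h]
  exact h.choose_spec.2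

/-- A sequence of low sets; at stage `⟨i, e⟩`, a solution of the instance with index `e` relative
to the `i`-th set is added. -/
noncomputable def lowSequence : ℕ → Set ℕ
  | 0 => ∅
  -- The recursion sees only the previous term; removing its left halves `n - i` times recovers the
  -- `i`-th one.
  | n + 1 => join (solution (ceSet (rightPart^[n - n.unpair.1] (lowSequence n)) n.unpair.2)
      (lowSequence n)) (lowSequence n)

theorem turingLE_lowSequence_succ (n : ℕ) : TuringLE (lowSequence n) (lowSequence (n + 1)) :=
  TuringLE.join_right _ _

theorem low_lowSequence (n : ℕ) : Low (lowSequence n) := by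
  induction n with
  | zero => exact TuringLE.refl _
  | succ n ih => exact TuringLE.trans (lowOver_solution _ _) ih

theorem rightPart_iterate_lowSequence (i k : ℕ) :
    rightPart^[k] (lowSequence (i + k)) = lowSequence i := by
  induction k with
  | zero => rfl
  | succ k ih => rw [Function.iterate_succ_apply, ← add_assoc, lowSequence, rightPart_join, ih]

theorem low_of_mem_lowerClosure {A : Set ℕ} (hA : A ∈ lowerClosure lowSequence) : Low A :=
  hA.elim fun n h => h.jump.trans (low_lowSequence n)

theorem wsrrt22_lowerClosure : (omegaStructure (lowerClosure lowSequence)).WSRRT22 := by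
  rintro F ⟨i, hF⟩ h1 h2 h3
  have hinst : IsInstance F := ⟨h1, h2, h3⟩
  obtain ⟨e, he⟩ := CEIn.exists_ceSet_eq (turingLE_iff.1 hF).1
  have hi : i ≤ Nat.pair i e := Nat.left_le_pair i e
  have hF' := hF.trans (turingLE_of_le turingLE_lowSequence_succ hi)
  have hseq : lowSequence (Nat.pair i e + 1) =
      join (solution F (lowSequence (Nat.pair i e))) (lowSequence (Nat.pair i e)) := by
    have := rightPart_iterate_lowSequence i (Nat.pair i e - i)
    rw [Nat.add_sub_cancel' hi] at this
    rw [lowSequence, Nat.unpair_pair]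
    simp only [this, he]
  obtain ⟨h4, h5⟩ := hinst.solves_solution hF'
  refine ⟨solution F (lowSequence (Nat.pair i e)), ⟨Nat.pair i e + 1, ?_⟩, h4, h5⟩
  rw [hseq]
  exact TuringLE.join_left _ _

/-! ### Approximating sets computable in the first jump -/

/-- Initial segments of `∅` are strings of `false`, so the test can be run without an oracle; it
accepts from some stage on or never. -/
theorem CEIn.exists_primrec_stages {α : Type*} [Primcodable α] {P : α → Prop}
    (hP : CEIn ∅ P) : ∃ T : α → ℕ → Prop, PrimrecPred (fun p : α × ℕ => T p.1 p.2) ∧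
      ∀ a, ∀ᶠ s in atTop, (T a s ↔ P a) := by
  obtain ⟨Q, hQ, hmono, eQ⟩ := hP
  have he : ∀ n, initSeg ∅ n = (List.range n).map fun _ => false := fun n => by simp [initSeg]
  refine ⟨fun a s => Q ((List.range s).map fun _ => false) a, ?_, fun a => ?_⟩
  · refine hQ.comp (f := fun p : α × ℕ => ((List.range p.2).map fun _ => false, p.1)) ?_
    exact (Primrec.list_map (Primrec.list_range.comp Primrec.snd) (Primrec₂.const false)).pair
      Primrec.fst
  · by_cases h : P a
    · obtain ⟨n, hn⟩ := (eQ a).1 h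
      filter_upwards [eventually_ge_atTop n] with s hs
      rw [← he]
      exact iff_of_true (hmono _ _ a (initSeg_prefix _ hs) hn) h
    · refine Eventually.of_forall fun s => iff_of_false (fun hs => h ?_) h
      simp only [← he] at hs
      exact (eQ a).2 ⟨s, hs⟩

/-- A primitive recursive approximation to all sets computable in `∅'`. -/
theorem exists_primrec_approximation : ∃ r : ℕ → ℕ → ℕ → Prop,
    PrimrecPred (fun p : (ℕ × ℕ) × ℕ => r p.1.1 p.1.2 p.2) ∧
    ∀ R, TuringLE R (jump ∅) → ∃ e, ∀ x, ∀ᶠ s in atTop, (r e s x ↔ x ∈ R) := by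
  classical
  obtain ⟨T, hT, hlim⟩ := (CEIn.jump ∅).exists_primrec_stages
  let K : ℕ → ℕ → List Bool := fun s k => (List.range k).map fun i => decide (T i s)
  have hK : Primrec fun p : ℕ × ℕ => K p.1 p.2 := by
    refine Primrec.list_map (Primrec.list_range.comp Primrec.snd) ?_
    exact (hT.comp (f := fun p : (ℕ × ℕ) × ℕ => (p.2, p.1.1)) (by fun_prop)).decide
  have hKlim : ∀ k, ∀ᶠ s in atTop, ∀ j ≤ k, K s j = initSeg (jump ∅) j := by
    intro k
    have : ∀ᶠ s in atTop, ∀ i ∈ Set.Iio k, (T i s ↔ i ∈ jump ∅) :=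
      (eventually_all_finite (Set.finite_Iio k)).2 fun i _ => hlim i
    filter_upwards [this] with s hs j hj
    simp only [K, initSeg, List.map_inj_left, List.mem_range]
    intro i hi
    simp [hs i (show i < k by omega)]
  let C : ℕ → ℕ → ℕ → ℕ → Prop := fun e s x k =>
    ((Denumerable.ofNat Nat.Partrec.Code e).evaln s (Encodable.encode (K s k, x))).isSome = true
  have hC : PrimrecPred fun p : ((ℕ × ℕ) × ℕ) × ℕ => C p.1.1.1 p.1.1.2 p.1.2 p.2 := by
    have : Primrec fun p : ((ℕ × ℕ) × ℕ) × ℕ => K p.1.1.2 p.2 :=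
      hK.comp (g := fun p : ((ℕ × ℕ) × ℕ) × ℕ => (p.1.1.2, p.2)) (by fun_prop)
    simp only [C]
    fun_prop
  have hC1 : ∀ e x k, ((Denumerable.ofNat Nat.Partrec.Code e).eval
      (Encodable.encode (initSeg (jump ∅) k, x))).Dom → ∀ᶠ s in atTop, C e s x k := by
    intro e x k h
    obtain ⟨a, ha⟩ := Part.dom_iff_mem.1 h
    obtain ⟨t, ht⟩ := Nat.Partrec.Code.evaln_complete.1 ha
    filter_upwards [hKlim k, eventually_ge_atTop t] with s hs hts
    simp only [C, hs k le_rfl]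
    exact Option.isSome_iff_exists.2 ⟨a, Nat.Partrec.Code.evaln_mono hts ht⟩
  have hC2 : ∀ e s x k, K s k = initSeg (jump ∅) k → C e s x k → x ∈ ceSet (jump ∅) e := by
    intro e s x k hk h
    simp only [C, hk] at h
    obtain ⟨a, ha⟩ := Option.isSome_iff_exists.1 h
    exact ⟨k, Part.dom_iff_mem.2 ⟨a, Nat.Partrec.Code.evaln_sound ha⟩⟩
  -- Here `e` codes indices of `R` and of its complement. At stage `s`, accept `x` when the first
  -- index halts on a segment shorter than any on which the second halts. Approximated segments
  -- settle up to the true use, so in the limit the correct index has a correct computation, and an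
  -- opposing one on a segment no longer than it is impossible.
  refine ⟨fun e s x => ∃ k < s, C e.unpair.1 s x k ∧ ∀ j < k + 1, ¬ C e.unpair.2 s x j, ?_, ?_⟩
  · refine primrecPred_exists_lt (PrimrecPred.and ?_ (primrecPred_forall_lt (PrimrecPred.not ?_)
      (by fun_prop))) (by fun_prop)
    · exact hC.comp (f := fun p : ((ℕ × ℕ) × ℕ) × ℕ =>
        (((p.1.1.1.unpair.1, p.1.1.2), p.1.2), p.2)) (by fun_prop)
    · exact hC.comp (f := fun p : (((ℕ × ℕ) × ℕ) × ℕ) × ℕ =>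
        (((p.1.1.1.1.unpair.2, p.1.1.1.2), p.1.1.2), p.2)) (by fun_prop)
  · intro R hR
    obtain ⟨e₁, h₁⟩ := CEIn.exists_ceSet_eq (turingLE_iff.1 hR).1
    obtain ⟨e₂, h₂⟩ := CEIn.exists_ceSet_eq (B := Rᶜ) (turingLE_iff.1 hR).2
    refine ⟨Nat.pair e₁ e₂, fun x => ?_⟩
    simp only [Nat.unpair_pair]
    by_cases hx : x ∈ R
    · obtain ⟨k, hk⟩ : x ∈ ceSet (jump ∅) e₁ := h₁ ▸ hx
      filter_upwards [hC1 _ _ _ hk, hKlim k, eventually_gt_atTop k] with s h h' hs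
      refine iff_of_true ⟨k, hs, h, fun j hj hc => ?_⟩ hx
      have := hC2 _ _ _ _ (h' j (by omega)) hc
      rw [h₂] at this
      exact this hx
    · obtain ⟨k, hk⟩ : x ∈ ceSet (jump ∅) e₂ := h₂ ▸ (show x ∈ Rᶜ from hx)
      filter_upwards [hC1 _ _ _ hk, hKlim k] with s h h'
      refine iff_of_false ?_ hx
      rintro ⟨j, -, hj, hall⟩
      have hjk : j < k := by
        by_contra! hkj
        exact hall k (by omega) h
      have := hC2 _ _ _ _ (h' j hjk.le) hj
      rw [h₁] at this
      exact hx this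

/-! ### A coloring without rainbows computable in the first jump -/

section Diagonal

open Classical in
/-- The first two numbers below `s` that are outside `u` and seem to be in the `e`-th set. -/
noncomputable def pick (r : ℕ → ℕ → ℕ → Prop) (s e : ℕ) (u : List ℕ) : List ℕ :=
  if 2 ≤ ((List.range s).filter fun x => r e s x ∧ ¬ x ∈ u).length then
    ((List.range s).filter fun x => r e s x ∧ ¬ x ∈ u).take 2 else []

/-- The pairs chosen for the first `e` sets at stage `s`, one after the other. -/
noncomputable def picked (r : ℕ → ℕ → ℕ → Prop) (s : ℕ) : ℕ → List ℕ
  | 0 => []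
  | e + 1 => picked r s e ++ pick r s e (picked r s e)

/-- At stage `s`, the two members of each chosen pair get the same color, and all other numbers get
colors of their own. -/
noncomputable def diagonalColoring (r : ℕ → ℕ → ℕ → Prop) (x s : ℕ) : ℕ :=
  -- Chosen pairs occupy positions `2 * i` and `2 * i + 1`, so halving the position identifies the
  -- pair. Even and odd codes keep these colors apart from the individual ones.
  if x ∈ picked r s s then Nat.pair s (2 * ((picked r s s).idxOf x).div2)
  else Nat.pair s (2 * x + 1)

variable {r : ℕ → ℕ → ℕ → Prop}

theorem primrec_diagonalColoring (hr : PrimrecPred fun p : (ℕ × ℕ) × ℕ => r p.1.1 p.1.2 p.2) :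
    Primrec fun p : ℕ × ℕ => diagonalColoring r p.1 p.2 := by
  classical
  have h1 : Primrec fun p : (ℕ × ℕ) × List ℕ =>
      (List.range p.1.1).filter fun x => r p.1.2 p.1.1 x ∧ ¬ x ∈ p.2 := by
    refine (PrimrecRel.listFilter (R := fun (x : ℕ) (p : (ℕ × ℕ) × List ℕ) =>
      r p.1.2 p.1.1 x ∧ ¬ x ∈ p.2) (PrimrecPred.and ?_ (by fun_prop))).comp
      (Primrec.list_range.comp (by fun_prop)) Primrec.id
    exact hr.comp (f := fun p : ℕ × (ℕ × ℕ) × List ℕ => ((p.2.1.2, p.2.1.1), p.1)) (by fun_prop)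
  have h2 : Primrec fun p : (ℕ × ℕ) × List ℕ => pick r p.1.1 p.1.2 p.2 := by
    unfold pick
    exact Primrec.ite (by fun_prop) (by fun_prop) (by fun_prop)
  have h3 : Primrec fun p : ℕ × ℕ => picked r p.1 p.2 := by
    refine (Primrec.nat_rec' (f := fun p : ℕ × ℕ => p.2) (g := fun _ => ([] : List ℕ))
      (h := fun p q => q.2 ++ pick r p.1 q.1 q.2) (by fun_prop) (by fun_prop) ?_).of_eq fun p => ?_
    · refine Primrec.list_append.comp (by fun_prop) ?_
      exact h2.comp (g := fun p : (ℕ × ℕ) × ℕ × List ℕ => ((p.1.1, p.2.1), p.2.2)) (by fun_prop)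
    · generalize p.2 = e
      induction e with
      | zero => rfl
      | succ e ih => simp only [picked, ih]
  have h4 : Primrec fun p : ℕ × ℕ => picked r p.2 p.2 :=
    h3.comp (g := fun p : ℕ × ℕ => (p.2, p.2)) (by fun_prop)
  have h5 : Primrec fun p : ℕ × ℕ => ((picked r p.2 p.2).idxOf p.1).div2 :=
    Primrec.nat_div2.comp (Primrec.list_idxOf.comp Primrec.fst h4)
  unfold diagonalColoring
  exact Primrec.ite (by fun_prop) (by fun_prop) (by fun_prop)

/-- The color determines `s`, and then either `x` itself or half of its position in the list, which
at most two positions share. -/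
theorem twoBounded_diagonalColoring (r : ℕ → ℕ → ℕ → Prop) : TwoBounded (diagonalColoring r) := by
  have key : ∀ {x s y t : ℕ}, diagonalColoring r x s = diagonalColoring r y t → s = t ∧
      (x = y ∨ (x ∈ picked r s s ∧ y ∈ picked r s s ∧
        ((picked r s s).idxOf x).div2 = ((picked r s s).idxOf y).div2)) := by
    intro x s y t h
    by_cases hx : x ∈ picked r s s <;> by_cases hy : y ∈ picked r t t <;>
      simp only [diagonalColoring, hx, hy, if_true, if_false, Nat.pair_eq_pair] at h <;>
      obtain ⟨rfl, h⟩ := h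
    · exact ⟨rfl, Or.inr ⟨hx, hy, by omega⟩⟩
    · omega
    · omega
    · exact ⟨rfl, Or.inl (by omega)⟩
  refine twoBounded_iff.2 ?_
  rintro ⟨x, s⟩ ⟨y, t⟩ ⟨z, t'⟩ - - - h1 h2
  simp only at h1 h2
  obtain ⟨rfl, h3⟩ := key h1
  obtain ⟨rfl, h4⟩ := key h2
  clear h1 h2
  rcases h3 with rfl | ⟨hx, hy, h1⟩
  · exact Or.inl rfl
  rcases h4 with rfl | ⟨-, hz, h2⟩
  · exact Or.inr (Or.inl rfl)
  rw [Nat.div2_val, Nat.div2_val] at h1 h2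
  have : (picked r s s).idxOf x = (picked r s s).idxOf y ∨
      (picked r s s).idxOf x = (picked r s s).idxOf z ∨
      (picked r s s).idxOf y = (picked r s s).idxOf z := by omega
  rcases this with h | h | h
  · exact Or.inl (by rw [(List.idxOf_inj hx).1 h])
  · exact Or.inr (Or.inl (by rw [(List.idxOf_inj hx).1 h]))
  · exact Or.inr (Or.inr (by rw [(List.idxOf_inj hy).1 h]))

theorem length_pick (s e : ℕ) (u : List ℕ) :
    (pick r s e u).length = 0 ∨ (pick r s e u).length = 2 := by
  unfold pick
  split_ifs with h
  · right; rw [List.length_take]; omega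
  · left; rfl

/-- Evenness keeps chosen pairs aligned with halved positions; the bound leaves room for the `e`-th
set to choose. -/
theorem length_picked (r : ℕ → ℕ → ℕ → Prop) (s e : ℕ) :
    Even (picked r s e).length ∧ (picked r s e).length ≤ 2 * e := by
  induction e with
  | zero => simp [picked]
  | succ e ih =>
    obtain ⟨⟨k, hk⟩, h⟩ := ih
    rw [picked, List.length_append]
    rcases length_pick (r := r) s e (picked r s e) with h' | h' <;> rw [h']
    · exact ⟨⟨k, by omega⟩, by omega⟩
    · exact ⟨⟨k + 1, by omega⟩, by omega⟩

theorem picked_prefix {s m n : ℕ} (h : m ≤ n) : picked r s m <+: picked r s n :=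
  Nat.le_induction (List.prefix_rfl) (fun _ _ ih => ih.trans (List.prefix_append _ _)) n h

/-- At a large stage `s ∈ R`, the approximation is correct below `M`, so the pair chosen for `e`
consists of elements `a, b` of `R`, and `(a, s)`, `(b, s)` get the same color. -/
theorem not_isRainbow_diagonalColoring {e : ℕ} {R : Set ℕ} (hR : R.Infinite)
    (hlim : ∀ x, ∀ᶠ s in atTop, (r e s x ↔ x ∈ R)) : ¬ IsRainbow (diagonalColoring r) R := by
  classical
  intro hrain
  -- Earlier indices take at most `2 * e` numbers, so at least two of these `2 * e + 2` elements
  -- remain available.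
  obtain ⟨t, htR, htc⟩ := hR.exists_subset_card_eq (2 * e + 2)
  obtain ⟨M, hM⟩ := t.exists_nat_subset_range
  have hev : ∀ᶠ s in atTop, ∀ x ∈ Set.Iio M, (r e s x ↔ x ∈ R) :=
    (eventually_all_finite (Set.finite_Iio M)).2 fun x _ => hlim x
  obtain ⟨N, hN⟩ := eventually_atTop.1 hev
  obtain ⟨s, hsR, hs⟩ := hR.exists_gt (N + M + e)
  replace hN := hN s (by omega)
  set u := picked r s e with hu
  set l := (List.range M).filter fun x => r e s x ∧ ¬ x ∈ u with hl
  have hl2 : 2 ≤ l.length := by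
    have h1 : t \ u.toFinset ⊆ l.toFinset := by
      intro x hx
      rw [Finset.mem_sdiff, List.mem_toFinset] at hx
      have hxM := Finset.mem_range.1 (hM hx.1)
      simp only [hl, List.mem_toFinset, List.mem_filter, List.mem_range, decide_eq_true_eq]
      exact ⟨hxM, (hN x hxM).2 (htR hx.1), hx.2⟩
    have h2 := Finset.card_le_card h1
    have h3 := Finset.le_card_sdiff u.toFinset t
    have h4 := u.toFinset_card_le
    have h5 := l.toFinset_card_le
    have h6 := (length_picked r s e).2
    rw [← hu] at h6
    omega
  obtain ⟨a, b, l', hab⟩ : ∃ a b l', l = a :: b :: l' := by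
    match l, hl2 with
    | a :: b :: l', _ => exact ⟨a, b, l', rfl⟩
  -- The approximation may be wrong between `M` and `s`, but candidates found there come after those
  -- below `M` and do not affect the first two.
  have hpick : pick r s e u = [a, b] := by
    have : (List.range s).filter (fun x => r e s x ∧ ¬ x ∈ u) = l ++
        ((List.range (s - M)).map (M + ·)).filter fun x => r e s x ∧ ¬ x ∈ u := by
      rw [hl, ← List.filter_append, ← List.range_add, Nat.add_sub_cancel' (by omega)]
    rw [pick, this, hab]
    simp
  have hmem : ∀ x ∈ l, x < M ∧ x ∈ R ∧ x ∉ u := by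
    intro x hx
    simp only [hl, List.mem_filter, List.mem_range, decide_eq_true_eq] at hx
    exact ⟨hx.1, (hN x hx.1).1 hx.2.1, hx.2.2⟩
  obtain ⟨haM, haR, hau⟩ := hmem a (by simp [hab])
  obtain ⟨hbM, hbR, hbu⟩ := hmem b (by simp [hab])
  have hne : a ≠ b := by
    have : l.Nodup := List.nodup_range.filter _
    rw [hab] at this
    simp only [List.nodup_cons, List.mem_cons, not_or] at this
    exact this.1.1
  obtain ⟨ρ, hρ⟩ := picked_prefix (r := r) (s := s) (show e + 1 ≤ s by omega)
  rw [picked, ← hu, hpick, List.append_assoc] at hρ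
  have hia : (picked r s s).idxOf a = u.length := by
    rw [← hρ, List.idxOf_append_of_notMem hau]
    simp
  have hib : (picked r s s).idxOf b = u.length + 1 := by
    rw [← hρ, List.idxOf_append_of_notMem hbu]
    simp [List.idxOf_cons_ne _ hne]
  obtain ⟨k, hk⟩ := (length_picked r s e).1
  rw [← hu] at hk
  have hcol : diagonalColoring r a s = diagonalColoring r b s := by
    unfold diagonalColoring
    rw [if_pos (by rw [← hρ]; simp), if_pos (by rw [← hρ]; simp), hia, hib]
    simp only [Nat.div2_val]
    congr 2
    omega
  exact hne (isRainbow_iff.1 hrain a haR s hsR b hbR s hsR (by omega) (by omega) hcol).1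

end Diagonal

/-! ### The separation of the two principles. -/

theorem not_rrt22_lowerClosure : ¬ (omegaStructure (lowerClosure lowSequence)).RRT22 := by
  intro hrrt
  obtain ⟨r, hr, happrox⟩ := exists_primrec_approximation
  have hf := primrec_diagonalColoring hr
  set f := diagonalColoring r with hfdef
  -- A pairing code bounds its components, so the quantifiers can be bounded and `F` is primitive
  -- recursive.
  let F : Set ℕ := {n | ∃ x < n + 1, ∃ y < n + 1, arithPair (arithPair x y) (f x y) = n}
  have hle : ∀ i j, i ≤ arithPair i j ∧ j ≤ arithPair i j := by
    intro i j
    unfold arithPair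
    exact ⟨by omega, by nlinarith⟩
  have hcolor : ∀ x y c : ℕ, arithPair (arithPair x y) c ∈ F ↔ f x y = c := by
    intro x y c
    constructor
    · rintro ⟨x', -, y', -, h⟩
      obtain ⟨h1, h2⟩ := arithPair_inj h
      obtain ⟨rfl, rfl⟩ := arithPair_inj h1
      exact h2
    · rintro rfl
      have h1 := hle (arithPair x y) (f x y)
      have h2 := hle x y
      exact ⟨x, by omega, y, by omega, rfl⟩
  have hF : PrimrecPred fun n => n ∈ F := by
    refine primrecPred_exists_lt (primrecPred_exists_lt ?_ (by fun_prop)) (by fun_prop)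
    have : Primrec fun p : (ℕ × ℕ) × ℕ => f p.1.2 p.2 :=
      hf.comp (g := fun p : (ℕ × ℕ) × ℕ => (p.1.2, p.2)) (by fun_prop)
    fun_prop
  have hcol : (omegaStructure (lowerClosure lowSequence)).IsColoring F := fun x y _ =>
    ⟨f x y, (hcolor _ _ _).2 rfl, fun c hc => ((hcolor _ _ _).1 hc).symm⟩
  have hb : (omegaStructure (lowerClosure lowSequence)).TwoBounded F := by
    intro c x₁ y₁ x₂ y₂ x₃ y₃ l1 l2 l3 h1 h2 h3
    replace h1 := (hcolor _ _ _).1 h1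
    replace h2 := (hcolor _ _ _).1 h2
    replace h3 := (hcolor _ _ _).1 h3
    have := twoBounded_iff.1 (twoBounded_diagonalColoring r) (x₁, y₁) (x₂, y₂) (x₃, y₃) l1 l2 l3
      (h1.trans h2.symm) (h1.trans h3.symm)
    exact this.imp Prod.ext_iff.1 (Or.imp Prod.ext_iff.1 Prod.ext_iff.1)
  obtain ⟨R, hRS, hinf, hrain⟩ := hrrt F
    ⟨0, turingLE_iff.2 ⟨CEIn.prim hF, CEIn.prim hF.not⟩⟩ hcol hb
  have hlow := low_of_mem_lowerClosure hRS
  -- Lowness gives `R ≤ R' ≤ ∅'` in the Turing order, so `R` is among the approximated sets.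
  obtain ⟨e, he⟩ := happrox R ((TuringLE.refl R).le_jump.trans hlow)
  refine not_isRainbow_diagonalColoring (Set.infinite_of_forall_exists_gt hinf) he ?_
  refine isRainbow_iff.2 fun x₁ hx₁ y₁ hy₁ x₂ hx₂ y₂ hy₂ h1 h2 h => ?_
  exact hrain x₁ hx₁ y₁ hy₁ x₂ hx₂ y₂ hy₂ h1 h2 (f x₁ y₁) ((hcolor _ _ _).2 rfl)
    ((hcolor _ _ _).2 h.symm)

end RainbowRamsey

open RainbowRamsey

theorem mainTheorem5 :
    (∀ (X : Set ℕ) (f : ℕ → ℕ → ℕ), ColoringComputableIn X f → TwoBounded f →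
      WeaklyRainbowStable f → ∃ R : Set ℕ, R.Infinite ∧ IsRainbow f R ∧ LowOver R X) ∧
    (∃ S : Set (Set ℕ), (omegaStructure S).ModelsRCA₀ ∧ (omegaStructure S).WSRRT22 ∧
      ∀ A ∈ S, Low A) ∧
    ¬ ImpliesOverRCA₀ L2Structure.WSRRT22 L2Structure.RRT22 :=
  ⟨fun _ _ => exists_rainbow_lowOver_of_computableIn,
    ⟨lowerClosure lowSequence, modelsRCA₀_lowerClosure turingLE_lowSequence_succ,
      wsrrt22_lowerClosure, fun _ => low_of_mem_lowerClosure⟩,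
    fun h => not_rrt22_lowerClosure
      (h _ (modelsRCA₀_lowerClosure turingLE_lowSequence_succ) wsrrt22_lowerClosure)⟩
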